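/- Let $\mathbb{R}^{1,2}$ be $\mathbb{R}^3$ with $\langle x,y\rangle=-x_0y_0+x_1y_1+x_2y_2$, let $x\boxtimes y$ be the vector with $\langle x\boxtimes y,v\rangle=\det(x,y,v)$ for all $v$, and let $\mathbb{H}^2=\{x:\langle x,x\rangle=-1,\ x_0>0\}$ with the induced metric $g$, Levi-Civita connection $\nabla$ and complex structure $J_pv=p\boxtimes v$. The Hessian of a function $u$ is the $(1,1)$-tensor $\mathrm{Hess}\,u(v)=\nabla_v\,\mathrm{grad}\,u$, and $\Delta u=\mathrm{tr}\,\mathrm{Hess}\,u$. The connection $\nabla$ splits $T_{(p,v)}T\mathbb{H}^2$ into horizontal and vertical parts, each identified with $T_p\mathbb{H}^2$. In this splitting let $$\mathbb{G}\big((X_1,X_2),(Y_1,Y_2)\big)=g(X_1,Y_2)+g(X_2,Y_1),\qquad \Omega\big((X_1,X_2),(Y_1,Y_2)\big)=g(JX_1,Y_2)-g(X_2,JY_1).$$ A smooth vector field $V$ on $\mathbb{H}^2$ is called \emph{harmonic Lagrangian} if the map $V:(\mathbb{H}^2,g)\to(T\mathbb{H}^2,\mathbb{G})$ is harmonic (its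 tension field vanishes) and $V(\mathbb{H}^2)$ is a Lagrangian surface for $\Omega$. Half-Pipe space is $\mathbb{HP}^3=\{[x,t]\in\mathbb{RP}^3: x\in\mathbb{R}^{1,2},\ t\in\mathbb{R},\ \langle x,x\rangle<0\}$. It is identified with $\mathbb{H}^2\times\mathbb{R}\subset\mathbb{R}^4$ and, by $[x,t]\mapsto(x_1/x_0,x_2/x_0,t/x_0)$, with the cylinder $\mathbb{D}^2\times\mathbb{R}$ (Klein model), where $\mathbb{D}^2$ is the open unit disk. Let $u:\mathbb{H}^2\to\mathbb{R}$ be smooth, with graph $S=\mathrm{gr}(u)\subset\mathbb{HP}^3$. * The connection $\nabla^{\mathbb{HP}^3}$ on $\mathbb{H}^2\times\mathbb{R}$ is defined by $D_XW=\nabla^{\mathbb{HP}^3}_XW+\langle X,W\rangle N$, where $D$ is the flat connection of $\mathbb{R}^4$, $N_x=x$, and $\langle\cdot,\cdot\rangle$ denotes the degenerate form $-x_0y_0+x_1y_1+x_2y_2$ on $\mathbb{R}^4$. Let $I$ be the first fundamental form of $S$, that is, the hyperbolic metric of the base, and let $T=(0,0,0,1)$. The second fundamental form $\mathrm{II}$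 and the shape operator $B$ of $S$ are defined, for $X,Y$ tangent to $S$, by $\nabla^{\mathbb{HP}^3}_XY=\nabla^I_XY+\mathrm{II}(X,Y)T$ and $\mathrm{II}(X,Y)=I(BX,Y)$. The surface $S$ is a \emph{mean surface} if $\mathrm{tr}\,B=0$. * The vector field $V_S$ associated with $S$ is $V_S(p)=p\boxtimes\sigma$, where $\sigma\in\mathbb{R}^{1,2}$ is the vector such that the tangent plane of $S$ at $(p,u(p))$ is, in the Klein model, $\{(\eta,t)\in\mathbb{D}^2\times\mathbb{R}:\langle(1,\eta),\sigma\rangle=t\}$. **Theorem.** Let $V$ be a smooth vector field on $\mathbb{H}^2$. The following are equivalent: 1. There is a smooth function $u:\mathbb{H}^2\to\mathbb{R}$ such that $S=\mathrm{gr}(u)$ is a mean surface in $\mathbb{HP}^3$ and $V=V_S$. 2. There is a smooth function $u:\mathbb{H}^2\to\mathbb{R}$ with $\Delta u-2u=0$ and $V=J\,\mathrm{grad}\,u$. 3. $V$ is harmonic Lagrangian. 4. The unique self-adjoint $(1,1)$-tensor $b$ on $\mathbb{H}^2$ with $\mathcal{L}_Vg=g(b\,\cdot,\cdot)$ satisfies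 $\mathrm{tr}(b)=0$ and $d^\nabla b=0$, where $d^\nabla b(X,Y)=\nabla_X(bY)-\nabla_Y(bX)-b([X,Y])$. -/

import Mathlib

open scoped ContDiff

noncomputable section

namespace HalfPipe

/-! ### Minkowski space and the hyperboloid model of the hyperbolic plane -/

/-- The vector space underlying Minkowski space `ℝ^{1,2}`. -/
abbrev Mink : Type := Fin 3 → ℝ

/-- The Minkowski bilinear form, of signature `(-,+,+)`. -/
def mink (x y : Mink) : ℝ := -(x 0 * y 0) + x 1 * y 1 + x 2 * y 2

/-- The Minkowski cross product `x ⊠ y`; see `mink_mcross`. -/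
def mcross (x y : Mink) : Mink :=
  ![-(x 1 * y 2 - x 2 * y 1), x 2 * y 0 - x 0 * y 2, x 0 * y 1 - x 1 * y 0]

/-- The defining property of the Minkowski cross product. -/
theorem mink_mcross (x y v : Mink) : mink (mcross x y) v = Matrix.det (Matrix.of ![x, y, v]) := by
  simp [mink, mcross, Matrix.det_fin_three]
  ring

theorem mink_comm (x y : Mink) : mink x y = mink y x := by
  simp only [mink]; ring

theorem mink_add_right (x y z : Mink) : mink x (y + z) = mink x y + mink x z := by
  simp only [mink, Pi.add_apply]; ring

theorem mink_smul_right (x : Mink) (c : ℝ) (y : Mink) : mink x (c • y) = c * mink x y := by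
  simp only [mink, Pi.smul_apply, smul_eq_mul]; ring

/-- The hyperbolic plane: the upper sheet of the two-sheeted hyperboloid. -/
def H2 : Type := {p : Mink // mink p p = -1 ∧ 0 < p 0}

instance : Coe H2 Mink := ⟨Subtype.val⟩

/-- The tangent space of `ℍ²` at `p`, the Minkowski-orthogonal complement of `p`. The hyperbolic
metric is the restriction of `mink` to it. -/
def Tan (p : H2) : Submodule ℝ Mink where
  carrier := {w | mink p w = 0}
  zero_mem' := by simp [mink]
  add_mem' := by
    intro a b ha hb
    simp only [Set.mem_ofPred_eq] at *
    rw [mink_add_right, ha, hb, add_zero]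
  smul_mem' := by
    intro c a ha
    simp only [Set.mem_ofPred_eq] at *
    rw [mink_smul_right, ha, mul_zero]

theorem mem_Tan {p : H2} {w : Mink} : w ∈ Tan p ↔ mink p w = 0 := Iff.rfl

/-- The Minkowski-orthogonal projection onto the tangent space at `p`. -/
def projT (p : H2) : Mink →ₗ[ℝ] Tan p where
  toFun y := ⟨y + mink p y • (p : Mink), by
    rw [mem_Tan, mink_add_right, mink_smul_right, p.2.1]; ring⟩
  map_add' y z := by
    ext i
    simp only [mink_add_right, Submodule.coe_add, Pi.add_apply, Pi.smul_apply, smul_eq_mul]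
    ring
  map_smul' c y := by
    ext i
    simp only [mink_smul_right, Submodule.coe_smul, Pi.add_apply, Pi.smul_apply, smul_eq_mul,
      RingHom.id_apply]
    ring

/-- The almost complex structure `J_p v = p ⊠ v` of `ℍ²`. -/
def J (p : H2) : Tan p →ₗ[ℝ] Tan p where
  toFun v := ⟨mcross p v, by
    simp [mem_Tan, mink, mcross]; ring⟩
  map_add' v w := by
    ext i
    fin_cases i <;> simp [mcross] <;> ring
  map_smul' c v := by
    ext i
    fin_cases i <;> simp [mcross] <;> ring

/-! ### The global chart and differential calculus on `ℍ²`

`ℍ²` is the graph of `x ↦ √(1 + |x|²)` over `ℝ²`; smoothness and derivatives on `ℍ²` are taken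
in the global chart `(x₀, x₁, x₂) ↦ (x₁, x₂)`. -/

/-- The spatial components `(x₁, x₂)` of a vector of `ℝ^{1,2}`. Restricted to `ℍ²` this is the
global chart, and restricted to a tangent space it is the differential of that chart. -/
def spatial : Mink →ₗ[ℝ] (Fin 2 → ℝ) where
  toFun w := ![w 1, w 2]
  map_add' v w := by ext i; fin_cases i <;> simp
  map_smul' c w := by ext i; fin_cases i <;> simp

/-- The inverse of the global chart. -/
def toH2 (x : Fin 2 → ℝ) : H2 :=
  ⟨![√(1 + x 0 ^ 2 + x 1 ^ 2), x 0, x 1], by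
    have h : (0 : ℝ) < 1 + x 0 ^ 2 + x 1 ^ 2 := by positivity
    refine ⟨?_, ?_⟩
    · simp [mink, Real.mul_self_sqrt h.le]; ring
    · simpa using Real.sqrt_pos.mpr h⟩

theorem spatial_toH2 (x : Fin 2 → ℝ) : spatial (toH2 x) = x := by
  ext i; fin_cases i <;> simp [spatial, toH2]

theorem toH2_spatial (p : H2) : toH2 (spatial p) = p := by
  have h := p.2.1
  have h0 := p.2.2
  simp only [mink] at h
  apply Subtype.ext
  ext i
  fin_cases i
  · simp only [toH2, spatial, LinearMap.coe_mk, AddHom.coe_mk]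
    simp only [Fin.zero_eta, Matrix.cons_val_zero, Matrix.cons_val_one]
    rw [show 1 + p.1 1 ^ 2 + p.1 2 ^ 2 = p.1 0 ^ 2 by linarith, Real.sqrt_sq h0.le]
  · simp [toH2, spatial]
  · simp [toH2, spatial]

/-- Smooth (`C^∞`) maps from `ℍ²` to a normed space. -/
def SmoothH2 {X : Type*} [NormedAddCommGroup X] [NormedSpace ℝ X] (F : H2 → X) : Prop :=
  ContDiff ℝ ∞ (F ∘ toH2)

/-- The differential `d_p F (w)` of a vector-valued map on `ℍ²`, for `w` tangent at `p`. -/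
def dH {X : Type*} [NormedAddCommGroup X] [NormedSpace ℝ X] (F : H2 → X) (p : H2) :
    Tan p →ₗ[ℝ] X :=
  (fderiv ℝ (F ∘ toH2) (spatial p)).toLinearMap ∘ₗ spatial ∘ₗ (Tan p).subtype

/-- (Not necessarily smooth) vector fields on `ℍ²`. -/
abbrev VField : Type := (p : H2) → Tan p

/-- A vector field seen as a map to Minkowski space. -/
def VField.amb (Y : VField) : H2 → Mink := fun p => (Y p : Mink)

/-- Smooth vector fields. -/
def SmoothVField (Y : VField) : Prop := SmoothH2 Y.amb

/-- The Levi-Civita connection `w ↦ ∇_w Y` of `ℍ²`: the tangential part of the flat derivative. -/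
def nabla (Y : VField) (p : H2) : Tan p →ₗ[ℝ] Tan p := projT p ∘ₗ dH Y.amb p

/-- The Lie bracket `[X, Y] = dY(X) - dX(Y)`. For smooth fields this vector is already tangent
(`bracket_coe`); the projection only records this in its type. -/
def bracket (X Y : VField) (p : H2) : Tan p :=
  projT p (dH Y.amb p (X p) - dH X.amb p (Y p))

theorem hasFDerivAt_mink_comp {E : Type*} [NormedAddCommGroup E] [NormedSpace ℝ E]
    {f g : E → Mink} {f' g' : E →L[ℝ] Mink} {x : E}
    (hf : HasFDerivAt f f' x) (hg : HasFDerivAt g g' x) :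
    ∃ m : E →L[ℝ] ℝ, HasFDerivAt (fun y => mink (f y) (g y)) m x ∧
      ∀ e, m e = mink (f' e) (g x) + mink (f x) (g' e) := by
  have hf' := hasFDerivAt_pi'.1 hf
  have hg' := hasFDerivAt_pi'.1 hg
  refine ⟨_, ((((hf' 0).mul (hg' 0)).neg).add ((hf' 1).mul (hg' 1))).add ((hf' 2).mul (hg' 2)), ?_⟩
  intro e
  simp [mink]
  ring

theorem differentiable_toH2 : Differentiable ℝ (fun x => (toH2 x : Mink)) := by
  rw [differentiable_pi]
  intro i
  fin_cases i
  · have : ∀ x : Fin 2 → ℝ, 1 + x 0 ^ 2 + x 1 ^ 2 ≠ 0 := fun x => by positivity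
    simp only [toH2, Fin.zero_eta, Matrix.cons_val_zero]
    exact Differentiable.sqrt (by fun_prop) this
  · simp only [toH2, Fin.mk_one, Matrix.cons_val_one, Matrix.cons_val_zero]
    fun_prop
  · simp only [toH2, Fin.reduceFinMk, Matrix.cons_val]
    fun_prop

/-- The differential of the inclusion `ℍ² → ℝ^{1,2}` is the inclusion of the tangent space. -/
theorem dH_coe (p : H2) (w : Tan p) : dH (fun q : H2 => (q : Mink)) p w = w := by
  have hd := (differentiable_toH2 (spatial p)).hasFDerivAt
  have hp : (toH2 (spatial p) : Mink) = p := by rw [toH2_spatial]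
  change fderiv ℝ (fun x => (toH2 x : Mink)) (spatial p) (spatial w) = w
  set f' := fderiv ℝ (fun x => (toH2 x : Mink)) (spatial p)
  obtain ⟨m, hm, hme⟩ := hasFDerivAt_mink_comp hd hd
  have h1 : ∀ i : Fin 2, f' (spatial w) i.succ = spatial w i := by
    intro i
    have h := (hasFDerivAt_pi'.1 hd) i.succ
    have h2 : HasFDerivAt (fun x : Fin 2 → ℝ => x i)
        (ContinuousLinearMap.proj (R := ℝ) (φ := fun _ : Fin 2 => ℝ) i) (spatial p) :=
      (ContinuousLinearMap.proj (R := ℝ) (φ := fun _ : Fin 2 => ℝ) i).hasFDerivAt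
    have e : (fun x => (toH2 x : Mink) i.succ) = fun x : Fin 2 → ℝ => x i := by
      ext x; fin_cases i <;> simp [toH2]
    rw [e] at h
    have := congrArg (fun L => L (spatial w)) (h.unique h2)
    simpa using this
  have h2 : m = 0 := by
    have e : (fun x => mink (toH2 x : Mink) (toH2 x)) = fun _ => (-1 : ℝ) := by
      ext x; exact (toH2 x).2.1
    rw [e] at hm
    exact hm.unique (hasFDerivAt_const _ _)
  have h3 := hme (spatial w)
  rw [h2, hp, mink_comm _ (p : Mink)] at h3
  have h4 := mem_Tan.1 w.2
  have e1 := h1 0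
  have e2 := h1 1
  simp [spatial] at e1 e2
  simp [mink] at h3 h4
  have h0 := p.2.2.ne'
  ext i
  fin_cases i
  · apply mul_left_cancel₀ h0
    simp [spatial] at h3
    simp only [spatial, LinearMap.coe_mk, AddHom.coe_mk, Fin.zero_eta]
    rw [e1, e2] at h3
    linear_combination (1 / 2) * h3 + h4
  · simpa [spatial] using e1
  · simpa [spatial] using e2

theorem SmoothVField.hasFDerivAt {Y : VField} (hY : SmoothVField Y) (x : Fin 2 → ℝ) :
    HasFDerivAt (Y.amb ∘ toH2) (fderiv ℝ (Y.amb ∘ toH2) x) x :=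
  ((ContDiff.differentiable (n := ∞) (f := Y.amb ∘ toH2) hY (by simp)) x).hasFDerivAt

/-- The differential of the relation `⟨p, Y p⟩ = 0`. -/
theorem mink_dH {Y : VField} (hY : SmoothVField Y) (p : H2) (w : Tan p) :
    mink w (Y p) + mink p (dH Y.amb p w) = 0 := by
  have hd := (differentiable_toH2 (spatial p)).hasFDerivAt
  obtain ⟨m, hm, hme⟩ := hasFDerivAt_mink_comp hd (hY.hasFDerivAt (spatial p))
  have h2 : m = 0 := by
    have e : (fun x => mink (toH2 x : Mink) ((Y.amb ∘ toH2) x)) = fun _ => (0 : ℝ) := by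
      ext x; exact (Y (toH2 x)).2
    rw [e] at hm
    exact hm.unique (hasFDerivAt_const _ _)
  have h3 := hme (spatial w)
  have h4 : fderiv ℝ (fun x => (toH2 x : Mink)) (spatial p) (spatial w) = w := dH_coe p w
  rw [h2, h4] at h3
  simp only [Function.comp_apply, toH2_spatial] at h3
  exact h3.symm

/-- The Lie bracket of smooth vector fields. -/
theorem bracket_coe {X Y : VField} (hX : SmoothVField X) (hY : SmoothVField Y) (p : H2) :
    (bracket X Y p : Mink) = dH Y.amb p (X p) - dH X.amb p (Y p) := by
  have h1 := mink_dH hY p (X p)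
  have h2 := mink_dH hX p (Y p)
  have h3 : mink p (dH Y.amb p (X p) - dH X.amb p (Y p)) = 0 := by
    rw [sub_eq_add_neg, ← neg_one_smul ℝ (dH X.amb p (Y p)), mink_add_right, mink_smul_right]
    rw [mink_comm (Y p : Mink)] at h2
    linarith
  simp [bracket, projT, h3]

/-- The connection `nabla` has no torsion. -/
theorem nabla_torsion (X Y : VField) (p : H2) :
    nabla Y p (X p) - nabla X p (Y p) = bracket X Y p := by
  simp [nabla, bracket]

/-- The connection `nabla` is compatible with the hyperbolic metric. -/
theorem nabla_metric {Y Z : VField} (hY : SmoothVField Y) (hZ : SmoothVField Z) (p : H2)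
    (w : Tan p) : dH (fun q => mink (Y q) (Z q)) p w =
      mink (nabla Y p w) (Z p) + mink (Y p) (nabla Z p w) := by
  obtain ⟨m, hm, hme⟩ :=
    hasFDerivAt_mink_comp (hY.hasFDerivAt (spatial p)) (hZ.hasFDerivAt (spatial p))
  have h1 : dH (fun q => mink (Y q) (Z q)) p w = m (spatial w) := by
    change fderiv ℝ (fun x => mink ((Y.amb ∘ toH2) x) ((Z.amb ∘ toH2) x)) (spatial p) (spatial w) = _
    rw [hm.fderiv]
  have hYp : mink (Y p) p = 0 := by rw [mink_comm]; exact (Y p).2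
  have hZp : mink (Z p) p = 0 := by rw [mink_comm]; exact (Z p).2
  rw [h1, hme, mink_comm (nabla Y p w : Mink)]
  simp only [nabla, projT, LinearMap.comp_apply, LinearMap.coe_mk, AddHom.coe_mk, mink_add_right,
    mink_smul_right, hYp, hZp, Function.comp_apply, toH2_spatial]
  rw [mink_comm]
  simp [dH, VField.amb]

/-- The gradient of a function on `ℍ²`; see `mink_grad`. -/
def grad (u : H2 → ℝ) : VField := fun p =>
  projT p ![0, fderiv ℝ (u ∘ toH2) (spatial p) (Pi.single 0 1),
    fderiv ℝ (u ∘ toH2) (spatial p) (Pi.single 1 1)]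

/-- The defining property of the gradient. -/
theorem mink_grad (u : H2 → ℝ) (p : H2) (w : Tan p) :
    mink (grad u p) w = dH u p w := by
  have hw : mink p w = 0 := w.2
  have hs : spatial (w : Mink) = (w : Mink) 1 • (Pi.single 0 1 : Fin 2 → ℝ)
      + (w : Mink) 2 • (Pi.single 1 1 : Fin 2 → ℝ) := by
    ext i; fin_cases i <;> simp [spatial]
  simp only [dH, LinearMap.comp_apply, Submodule.subtype_apply, ContinuousLinearMap.coe_coe]
  rw [hs, map_add, map_smul, map_smul]
  simp only [grad, projT, LinearMap.coe_mk, AddHom.coe_mk, smul_eq_mul]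
  rw [mink_comm, mink_add_right, mink_smul_right, mink_comm (w : Mink) p, hw]
  simp [mink]

/-- The hyperbolic Hessian `v ↦ ∇_v grad u`, a `(1,1)`-tensor. -/
def hess (u : H2 → ℝ) (p : H2) : Tan p →ₗ[ℝ] Tan p := nabla (grad u) p

/-- The Laplace-Beltrami operator, the trace of the Hessian. -/
def laplacian (u : H2 → ℝ) (p : H2) : ℝ := LinearMap.trace ℝ (Tan p) (hess u p)

/-! ### Tensors of type `(1,1)` -/

/-- Families of endomorphisms of the tangent spaces of `ℍ²`. -/
abbrev Tensor11 : Type := (p : H2) → (Tan p →ₗ[ℝ] Tan p)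

/-- The vector field `b(Y)`. -/
def Tensor11.app (b : Tensor11) (Y : VField) : VField := fun p => b p (Y p)

/-- Smooth `(1,1)`-tensors. -/
def Tensor11.Smooth (b : Tensor11) : Prop :=
  ∀ Y : VField, SmoothVField Y → SmoothVField (b.app Y)

/-- Self-adjointness with respect to the hyperbolic metric. -/
def Tensor11.SelfAdjoint (b : Tensor11) : Prop :=
  ∀ (p : H2) (v w : Tan p), mink (b p v) w = mink v (b p w)

/-- The Lie derivative `(L_V g)(X, Y) = g(X, ∇_Y V) + g(Y, ∇_X V)` of the hyperbolic metric. -/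
def lieMetric (V : VField) (p : H2) (X Y : Tan p) : ℝ :=
  mink X (nabla V p Y) + mink Y (nabla V p X)

/-- The formula defining `lieMetric` computes the Lie derivative:
`(L_V g)(X, Y) = V(g(X, Y)) - g([V, X], Y) - g(X, [V, Y])`. -/
theorem lieMetric_eq {V X Y : VField} (hX : SmoothVField X) (hY : SmoothVField Y) (p : H2) :
    lieMetric V p (X p) (Y p) = dH (fun q => mink (X q) (Y q)) p (V p)
      - mink (bracket V X p) (Y p) - mink (X p) (bracket V Y p) := by
  rw [nabla_metric hX hY, ← nabla_torsion, ← nabla_torsion]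
  simp only [lieMetric, mink, Submodule.coe_sub, Pi.sub_apply]
  ring

/-- The exterior derivative `d^∇ b (X, Y) = ∇_X (b Y) - ∇_Y (b X) - b [X, Y]`. -/
def dNabla (b : Tensor11) (X Y : VField) (p : H2) : Tan p :=
  nabla (b.app Y) p (X p) - nabla (b.app X) p (Y p) - b p (bracket X Y p)

/-- Codazzi tensors: `d^∇ b = 0`. -/
def Tensor11.Codazzi (b : Tensor11) : Prop :=
  ∀ X Y : VField, SmoothVField X → SmoothVField Y → ∀ p, dNabla b X Y p = 0

/-- `b` is a self-adjoint `(1,1)`-tensor with `L_V g = g(b ·, ·)`. -/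
def IsLieTensor (V : VField) (b : Tensor11) : Prop :=
  b.Smooth ∧ b.SelfAdjoint ∧ ∀ (p : H2) (X Y : Tan p), lieMetric V p X Y = mink (b p X) Y

/-! ### The pseudo-Kähler structure of `Tℍ²`

`Tℍ²` is the submanifold `{(p, v) | p ∈ ℍ², ⟨p, v⟩ = 0}` of `ℝ^{1,2} × ℝ^{1,2}`. -/

/-- The tangent space of `Tℍ²` at `(p, v)`, obtained by differentiating `⟨p, p⟩ = -1` and
`⟨p, v⟩ = 0`. -/
def TanT (p : H2) (v : Tan p) : Submodule ℝ (Mink × Mink) where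
  carrier := {ζ | mink p ζ.1 = 0 ∧ mink v ζ.1 + mink p ζ.2 = 0}
  zero_mem' := by simp [mink]
  add_mem' := by
    rintro a b ⟨ha, ha'⟩ ⟨hb, hb'⟩
    simp only [Set.mem_ofPred_eq, Prod.fst_add, Prod.snd_add, mink_add_right]
    constructor <;> linarith
  smul_mem' := by
    rintro c a ⟨ha, ha'⟩
    simp only [Set.mem_ofPred_eq, Prod.smul_fst, Prod.smul_snd, mink_smul_right]
    refine ⟨by rw [ha, mul_zero], ?_⟩
    linear_combination c * ha'

/-- The vertical lift of `w` at `(p, v)`: the velocity of `t ↦ (p, v + t w)`. -/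
def verLift (p : H2) (v w : Tan p) : TanT p v :=
  ⟨(0, w), by
    have := mem_Tan.1 w.2
    exact ⟨by simp [mink], by simpa [mink] using this⟩⟩

/-- The horizontal lift of `w` at `(p, v)`: the velocity of a parallel field with value `v` at `p`
along a curve with velocity `w`; see `horLift_of_parallel`. -/
def horLift (p : H2) (v w : Tan p) : TanT p v :=
  ⟨((w : Mink), mink v w • (p : Mink)), mem_Tan.1 w.2, by
    simp only [mink_smul_right, p.2.1]; ring⟩

/-- If `W` is a field along the curve `c` of `ℍ²` whose covariant derivative (the tangential part of
`W'`) vanishes at time `t`, then the velocity of `(c, W)` at `t` is the horizontal lift of that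
of `c`. -/
theorem horLift_of_parallel (c : ℝ → H2) (W : (s : ℝ) → Tan (c s)) (t : ℝ) (w : Tan (c t))
    (W' : Mink) (hc : HasDerivAt (fun s => (c s : Mink)) w t)
    (hW : HasDerivAt (fun s => (W s : Mink)) W' t) (hpar : projT (c t) W' = 0) :
    HasDerivAt (fun s => ((c s : Mink), (W s : Mink))) (horLift (c t) (W t) w) t := by
  have hW' : W' = mink (W t) w • (c t : Mink) := by
    obtain ⟨m, hm, hme⟩ := hasFDerivAt_mink_comp hc.hasFDerivAt hW.hasFDerivAt
    have h2 : m = 0 := by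
      have e : (fun s => mink (c s : Mink) (W s)) = fun _ => (0 : ℝ) := by
        ext s; exact (W s).2
      rw [e] at hm
      exact hm.unique (hasFDerivAt_const _ _)
    have h3 := hme 1
    rw [h2] at h3
    simp at h3
    have h4 : W' + mink (c t) W' • (c t : Mink) = 0 := congrArg Subtype.val hpar
    have h5 : mink (c t) W' = - mink (W t) w := by rw [mink_comm (W t : Mink)]; linarith
    rw [h5, neg_smul] at h4
    exact add_neg_eq_zero.1 h4
  have h := hc.prodMk hW
  rw [hW'] at h
  exact h

/-- The identification `T_pℍ² × T_pℍ² ≅ T_{(p,v)} Tℍ²`, `(w₁, w₂) ↦ w₁^H + w₂^V`. -/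
def splitT (p : H2) (v : Tan p) : (Tan p × Tan p) ≃ₗ[ℝ] TanT p v where
  toFun w := horLift p v w.1 + verLift p v w.2
  invFun ζ := (⟨ζ.1.1, ζ.2.1⟩, projT p ζ.1.2)
  map_add' w w' := by
    apply Subtype.ext
    simp only [horLift, verLift, Prod.fst_add, Prod.snd_add, Submodule.coe_add, Prod.mk_add_mk,
      mink_add_right, Prod.mk.injEq, add_smul]
    constructor <;> abel
  map_smul' c w := by
    apply Subtype.ext
    simp only [horLift, verLift, Prod.smul_fst, Prod.smul_snd, Submodule.coe_smul,
      Submodule.coe_add, Prod.mk_add_mk, mink_smul_right, Prod.smul_mk, RingHom.id_apply,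
      Prod.mk.injEq, smul_add, smul_smul, add_zero, and_true]
    simp
  left_inv w := by
    apply Prod.ext
    · apply Subtype.ext
      simp [horLift, verLift]
    · apply Subtype.ext
      have hw := mem_Tan.1 w.2.2
      simp only [horLift, verLift, projT, LinearMap.coe_mk, AddHom.coe_mk, Submodule.coe_add,
        Prod.mk_add_mk, mink_add_right, mink_smul_right, p.2.1, hw]
      ext i
      simp only [Pi.add_apply, Pi.smul_apply, smul_eq_mul]
      ring
  right_inv ζ := by
    apply Subtype.ext
    have h := ζ.2.2
    simp only [horLift, verLift, projT, LinearMap.coe_mk, AddHom.coe_mk, Submodule.coe_add,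
      Prod.mk_add_mk]
    apply Prod.ext
    · simp
    · ext i
      simp only [Pi.add_apply, Pi.smul_apply, smul_eq_mul]
      linear_combination ((p : Mink) i) * h

/-- The pseudo-Riemannian metric `𝔾` on `Tℍ²`, of signature `(2,2)`. -/
def bigG (p : H2) (v : Tan p) (ζ ξ : TanT p v) : ℝ :=
  mink ((splitT p v).symm ζ).1 ((splitT p v).symm ξ).2
    + mink ((splitT p v).symm ζ).2 ((splitT p v).symm ξ).1

/-- The symplectic form `Ω` on `Tℍ²`. -/
def bigOmega (p : H2) (v : Tan p) (ζ ξ : TanT p v) : ℝ :=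
  mink (J p ((splitT p v).symm ζ).1) ((splitT p v).symm ξ).2
    - mink ((splitT p v).symm ζ).2 (J p ((splitT p v).symm ξ).1)

/-- The differential at `p` of the global chart `p ↦ (p₁, p₂)` of `ℍ²`. The coordinate vector
fields are the images of the standard basis under its inverse. -/
def chartTan (p : H2) : Tan p ≃ₗ[ℝ] (Fin 2 → ℝ) where
  toFun w := spatial w
  map_add' v w := by simp
  map_smul' c w := by simp
  invFun a := ⟨![((p : Mink) 1 * a 0 + (p : Mink) 2 * a 1) / (p : Mink) 0, a 0, a 1], by
    have h0 := p.2.2.ne'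
    simp only [mem_Tan, mink]
    simp
    field_simp
    ring⟩
  left_inv w := by
    have h0 := p.2.2.ne'
    have hw := mem_Tan.1 w.2
    simp only [mink] at hw
    apply Subtype.ext
    ext i
    fin_cases i
    · simp [spatial]
      field_simp
      linarith
    · simp [spatial]
    · simp [spatial]
  right_inv a := by
    ext i
    fin_cases i <;> simp [spatial]

/-- The differential at `(p, v)` of the global chart `(p, v) ↦ (p₁, p₂, v₁, v₂)` of `Tℍ²`. -/
def chartTanT (p : H2) (v : Tan p) : TanT p v ≃ₗ[ℝ] (Fin 2 ⊕ Fin 2 → ℝ) where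
  toFun ζ := Sum.elim (spatial ζ.1.1) (spatial ζ.1.2)
  map_add' ζ ξ := by
    ext i; rcases i with i | i <;> simp
  map_smul' c ζ := by
    ext i; rcases i with i | i <;> simp
  invFun a := ⟨(((chartTan p).symm (a ∘ Sum.inl) : Mink),
      ![((p : Mink) 1 * a (Sum.inr 0) + (p : Mink) 2 * a (Sum.inr 1)
        + mink v ((chartTan p).symm (a ∘ Sum.inl))) / (p : Mink) 0, a (Sum.inr 0), a (Sum.inr 1)]),
      mem_Tan.1 ((chartTan p).symm (a ∘ Sum.inl)).2, by
        have h0 := p.2.2.ne'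
        generalize mink v ((chartTan p).symm (a ∘ Sum.inl)) = m
        simp only [mink]
        simp
        field_simp
        ring⟩
  left_inv ζ := by
    have h0 := p.2.2.ne'
    have h1 := ζ.2.1
    have h2 := ζ.2.2
    have e : (chartTan p).symm (spatial ζ.1.1) = ⟨ζ.1.1, h1⟩ :=
      (chartTan p).left_inv ⟨ζ.1.1, h1⟩
    apply Subtype.ext
    apply Prod.ext
    · simp [e]
    · simp only [Sum.elim_comp_inl, e, Sum.elim_inr]
      generalize mink v ζ.1.1 = m at *
      simp only [mink] at h2
      ext i
      fin_cases i
      · simp [spatial]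
        field_simp
        linarith
      · simp [spatial]
      · simp [spatial]
  right_inv a := by
    have e : spatial ((chartTan p).symm (a ∘ Sum.inl)) = a ∘ Sum.inl :=
      (chartTan p).right_inv (a ∘ Sum.inl)
    ext i
    rcases i with i | i
    · simp [e]
    · fin_cases i <;> simp [spatial]

/-- The differential `dV_p : T_pℍ² → T_{V(p)} Tℍ²` of a vector field seen as the map `p ↦ (p, V p)`
from `ℍ²` to `Tℍ²`, computed in the global charts; see `dSection_coe`. -/
def dSection (V : VField) (p : H2) (X : Tan p) : TanT p (V p) :=
  (chartTanT p (V p)).symm (Sum.elim (spatial X) (spatial (dH V.amb p X)))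

theorem dSection_coe {V : VField} (hV : SmoothVField V) (p : H2) (X : Tan p) :
    (dSection V p X : Mink × Mink) = ((X : Mink), dH V.amb p X) := by
  let ζ : TanT p (V p) := ⟨((X : Mink), dH V.amb p X), mem_Tan.1 X.2, by
    rw [mink_comm]; exact mink_dH hV p X⟩
  have h : (chartTanT p (V p)).symm (chartTanT p (V p) ζ) = ζ :=
    (chartTanT p (V p)).symm_apply_apply ζ
  exact congrArg Subtype.val h

/-- `V(ℍ²)` is a Lagrangian surface of `(Tℍ², Ω)`: at each of its points, `Ω` vanishes on the
tangent plane `dV_p(T_pℍ²)`. (The map `p ↦ (p, V p)` is an embedding, so that this plane always has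
dimension two, half the dimension of `Tℍ²`.) -/
def IsLagrangian (V : VField) : Prop :=
  ∀ (p : H2) (X Y : Tan p), bigOmega p (V p) (dSection V p X) (dSection V p Y) = 0

/-! ### Harmonic maps in coordinates -/

section Coordinates

variable {ι κ : Type*} [Fintype ι] [DecidableEq ι] [Fintype κ] [DecidableEq κ]

/-- Partial derivatives on a coordinate space. -/
def pderiv (i : ι) (f : (ι → ℝ) → ℝ) (x : ι → ℝ) : ℝ := fderiv ℝ f x (Pi.single i 1)

/-- The Christoffel symbols `Γ^k_{ij}` of the Levi-Civita connection of a pseudo-Riemannian metric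
given by its coefficients. -/
def christoffel (g : (ι → ℝ) → Matrix ι ι ℝ) (k i j : ι) (x : ι → ℝ) : ℝ :=
  (1 / 2) * ∑ l, (g x)⁻¹ k l *
    (pderiv i (fun y => g y j l) x + pderiv j (fun y => g y i l) x - pderiv l (fun y => g y i j) x)

/-- The component `(∇²F)(∂_i, ∂_j)^c` of the second covariant derivative
`∇²F(X, Y) = ∇^h_{dF(X)} dF(Y) - dF(∇^g_X Y)` of a map `F` between the metrics `g` and `h`. -/
def secondDeriv (g : (ι → ℝ) → Matrix ι ι ℝ) (h : (κ → ℝ) → Matrix κ κ ℝ)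
    (F : (ι → ℝ) → (κ → ℝ)) (i j : ι) (c : κ) (x : ι → ℝ) : ℝ :=
  pderiv i (fun y => pderiv j (fun z => F z c) y) x
    + ∑ a, ∑ b, christoffel h c a b (F x) *
        (pderiv i (fun y => F y a) x * pderiv j (fun y => F y b) x)
    - ∑ k, christoffel g k i j x * pderiv k (fun y => F y c) x

/-- The tension field `τ(F) = tr_g ∇²F` of a map between pseudo-Riemannian metrics. -/
def tension (g : (ι → ℝ) → Matrix ι ι ℝ) (h : (κ → ℝ) → Matrix κ κ ℝ)
    (F : (ι → ℝ) → (κ → ℝ)) (x : ι → ℝ) : κ → ℝ := fun c =>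
  ∑ i, ∑ j, (g x)⁻¹ i j * secondDeriv g h F i j c x

end Coordinates

/-- The coefficients `g_{ij}` of the hyperbolic metric in the global chart. -/
def gCoord (x : Fin 2 → ℝ) : Matrix (Fin 2) (Fin 2) ℝ :=
  Matrix.of fun i j =>
    mink ((chartTan (toH2 x)).symm (Pi.single i 1)) ((chartTan (toH2 x)).symm (Pi.single j 1))

/-- The coefficients of the metric `𝔾` in the global chart of `Tℍ²`. -/
def bigGCoord (q : Fin 2 ⊕ Fin 2 → ℝ) : Matrix (Fin 2 ⊕ Fin 2) (Fin 2 ⊕ Fin 2) ℝ :=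
  let p := toH2 (q ∘ Sum.inl)
  let v := (chartTan p).symm (q ∘ Sum.inr)
  Matrix.of fun A B =>
    bigG p v ((chartTanT p v).symm (Pi.single A 1)) ((chartTanT p v).symm (Pi.single B 1))

/-- The map `p ↦ (p, V p)` from `ℍ²` to `Tℍ²` in the global charts. -/
def sectionCoord (V : VField) (x : Fin 2 → ℝ) : Fin 2 ⊕ Fin 2 → ℝ :=
  Sum.elim x (chartTan (toH2 x) (V (toH2 x)))

/-- `V : (ℍ², g) → (Tℍ², 𝔾)` is a harmonic map: its tension field vanishes. -/
def IsHarmonicMap (V : VField) : Prop :=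
  ∀ x : Fin 2 → ℝ, tension gCoord bigGCoord (sectionCoord V) x = 0

/-- Harmonic Lagrangian vector fields. -/
def IsHarmonicLagrangian (V : VField) : Prop := IsHarmonicMap V ∧ IsLagrangian V

/-! ### Half-Pipe space

Half-Pipe space `ℍℙ³ = {[x, t] | ⟨x, x⟩ < 0}` is identified with `ℍ² × ℝ`, that is, with its lift
`{(x, t) | x ∈ ℍ²}` to `ℝ^{1,2} × ℝ = ℝ⁴`. In the Klein model it is the cylinder `𝔻² × ℝ`, where
`[x, t]` corresponds to `(x₁/x₀, x₂/x₀, t/x₀)`. -/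

/-- The tangent vector `(v, du(v))` of the graph of `u` at `(p, u p)` above `v ∈ T_pℍ²`. -/
def graphLift (u : H2 → ℝ) (p : H2) (v : Tan p) : Mink × ℝ := ((v : Mink), dH u p v)

/-- The Half-Pipe connection `∇^{ℍℙ³}_v W` at the point `(p, u p)` of the graph of `u`, for a vector
field `W` along the graph (as a function of the base point) and the tangent vector of the graph
above `v`: it is defined by `D_v W = ∇^{ℍℙ³}_v W + ⟨v, W⟩ N`, where `D` is the flat connection of
`ℝ⁴`, the degenerate form `⟨·,·⟩` is the pull-back of the Minkowski form, and `N_x = x`. -/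
def hpNabla (u : H2 → ℝ) (W : H2 → Mink × ℝ) (p : H2) (v : Tan p) : Mink × ℝ :=
  dH W p v - mink v (W p).1 • ((p : Mink), u p)

/-- `II` is the second fundamental form of the graph of `u`:
`∇^{ℍℙ³}_v W = ∇^I_v W + II(v, w) T` for every tangent field `W` of the graph, where `I`, the first
fundamental form, is the hyperbolic metric of the base and `T = (0, 1)` is the vertical field. -/
def IsSecondFundamentalForm (u : H2 → ℝ) (II : (p : H2) → Tan p → Tan p → ℝ) : Prop :=
  ∀ (p : H2) (v : Tan p) (Y : VField), SmoothVField Y →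
    hpNabla u (fun q => graphLift u q (Y q)) p v
      = graphLift u p (nabla Y p v) + II p v (Y p) • ((0 : Mink), (1 : ℝ))

/-- `B` is the shape operator of the graph of `u`: the self-adjoint tensor with
`II(v, w) = I(B v, w)`. -/
def IsShapeOperator (u : H2 → ℝ) (B : Tensor11) : Prop :=
  B.SelfAdjoint ∧ IsSecondFundamentalForm u (fun p v w => mink (B p v) w)

/-- The graph of `u` is a mean surface: the trace of its shape operator vanishes. -/
def IsMeanGraph (u : H2 → ℝ) : Prop :=
  ∃ B : Tensor11, IsShapeOperator u B ∧ ∀ p, LinearMap.trace ℝ (Tan p) (B p) = 0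

/-- The radial projection `Π(x) = (x₁/x₀, x₂/x₀)`. -/
def radial (x : Mink) : Fin 2 → ℝ := ![x 1 / x 0, x 2 / x 0]

/-- The disk of the Klein model. -/
def kleinDisk : Set (Fin 2 → ℝ) := {η | η 0 ^ 2 + η 1 ^ 2 < 1}

/-- The inverse `Π⁻¹(η) = (1, η) / √(1 - |η|²)` of the radial projection `ℍ² → 𝔻²`
(see `radial_kleinInv` and `kleinInv_radial`). -/
def kleinInv (η : Fin 2 → ℝ) : H2 := toH2 ((√(1 - η 0 ^ 2 - η 1 ^ 2))⁻¹ • η)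

theorem radial_kleinInv {η : Fin 2 → ℝ} (hη : η ∈ kleinDisk) : radial (kleinInv η) = η := by
  have h : (0 : ℝ) < 1 - η 0 ^ 2 - η 1 ^ 2 := by
    have : η 0 ^ 2 + η 1 ^ 2 < 1 := hη
    linarith
  have hs := Real.sqrt_pos.2 h
  have e : √(1 + ((√(1 - η 0 ^ 2 - η 1 ^ 2))⁻¹ * η 0) ^ 2 + ((√(1 - η 0 ^ 2 - η 1 ^ 2))⁻¹ * η 1) ^ 2)
      = (√(1 - η 0 ^ 2 - η 1 ^ 2))⁻¹ := by
    rw [Real.sqrt_eq_iff_mul_self_eq_of_pos (by positivity)]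
    have h2 := Real.sq_sqrt h.le
    field_simp
    linarith
  ext i
  fin_cases i <;> simp [radial, kleinInv, toH2, e] <;> field_simp

theorem kleinInv_radial (p : H2) : kleinInv (radial p) = p := by
  have h := p.2.1
  have h0 := p.2.2
  simp only [mink] at h
  have e : √(1 - radial p 0 ^ 2 - radial p 1 ^ 2) = ((p : Mink) 0)⁻¹ := by
    rw [Real.sqrt_eq_iff_mul_self_eq_of_pos (by positivity)]
    simp [radial]
    field_simp
    linarith
  rw [kleinInv, e]
  conv_rhs => rw [← toH2_spatial p]
  congr 1
  ext i
  fin_cases i <;> simp [radial, spatial] <;> field_simp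

/-- The function `ū` on the Klein disk with `u (Π⁻¹ η) = ū(η) / √(1 - |η|²)`; its graph is the graph
of `u` in the Klein model of Half-Pipe space. -/
def kleinFun (u : H2 → ℝ) (η : Fin 2 → ℝ) : ℝ := √(1 - η 0 ^ 2 - η 1 ^ 2) * u (kleinInv η)

/-- The tangent plane, in the Klein model, of the graph of `u` at the point above `p`. -/
def tangentPlane (u : H2 → ℝ) (p : H2) : Set ((Fin 2 → ℝ) × ℝ) :=
  {z | z.1 ∈ kleinDisk ∧ z.2 = kleinFun u (radial p)
    + fderiv ℝ (kleinFun u) (radial p) (z.1 - radial p)}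

/-- The spacelike plane `P_σ = {(η, t) | ⟨(1, η), σ⟩ = t}` of Half-Pipe space dual to `σ`. -/
def dualPlane (s : Mink) : Set ((Fin 2 → ℝ) × ℝ) :=
  {z | z.1 ∈ kleinDisk ∧ mink ![1, z.1 0, z.1 1] s = z.2}

/-- `V` is the vector field `V_S` associated with the graph `S` of `u`: `V_S(p) = p ⊠ σ` is the value
at `p` of the Killing field of the vector `σ` dual to the tangent plane of `S` above `p`. -/
def IsAssociatedField (u : H2 → ℝ) (V : VField) : Prop :=
  ∀ p : H2, ∃ s : Mink, tangentPlane u p = dualPlane s ∧ (V p : Mink) = mcross p s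

end HalfPipe

end

open HalfPipe

noncomputable section

namespace HalfPipe

/-! ### Partial derivatives -/

section PartialDerivatives

/-! Everything is governed by the function `Δu - 2u`.

Along a section, `dV(X)` has horizontal part `X` and vertical part `∇_X V`, so `V` pulls `Ω` back to
`tr(∇V)` times the area form, and Lagrangian means divergence-free (`isLagrangian_iff`). The tensor
`b` is the sum of `∇V` and its adjoint, so `tr b = 0` is the same condition
(`IsLieTensor.trace_eq`). By the Poincaré lemma on the chart `ℝ²`, a divergence-free field is `J
grad u` for some `u` (`exists_eq_J_grad`).

For `V = J grad u`, the two remaining conditions both measure `grad (Δu - 2u)`: the tension field is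
the vertical lift of `J grad (Δu - 2u)` (`tension_inl`, `tension_inr_zero`, `tension_inr_one`), and
`d^∇ b` is the area form times `grad (Δu - 2u)` (`curl_lieTensor_zero`, `curl_lieTensor_one`). Each
condition thus says that `Δu - 2u` is a constant `c`. Replacing `u` by `u + c/2` keeps `V` and makes
the constant zero (`exists_normalized_potential`).

On the Half-Pipe side, the graph of `u` has shape operator `Hess u - u`, of trace `Δu - 2u`
(`isMeanGraph_iff`), and its tangent plane at `p` is dual to `σ = grad u - u p`, so that `p ⊠ σ = J
grad u` because `p ⊠ p = 0` (`isAssociatedField_iff`).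

The identities are checked in the global chart, where, with `h` the height, `g_ij = δ_ij - x_i x_j /
h²`, `g^ij = δ_ij + x_i x_j` and `Γ^k_ij = -g_ij x_k`. -/

theorem _root_.ContDiff.differentiableAt_of_infty {E F : Type*} [NormedAddCommGroup E]
    [NormedSpace ℝ E] [NormedAddCommGroup F] [NormedSpace ℝ F] {f : E → F}
    (hf : ContDiff ℝ ∞ f) (x : E) : DifferentiableAt ℝ f x :=
  hf.differentiable (by simp) x

variable {ι : Type*} [DecidableEq ι]

theorem pderiv_const (i : ι) (c : ℝ) (x : ι → ℝ) : pderiv i (fun _ => c) x = 0 := by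
  simp [pderiv]

theorem pderiv_coord (i j : ι) (x : ι → ℝ) :
    pderiv i (fun y => y j) x = if j = i then 1 else 0 := by
  rw [pderiv, (hasFDerivAt_apply j x).fderiv]
  simp [Pi.single_apply]

variable [Fintype ι] {f g : (ι → ℝ) → ℝ} {x : ι → ℝ}

theorem pderiv_add (i : ι) (hf : DifferentiableAt ℝ f x) (hg : DifferentiableAt ℝ g x) :
    pderiv i (fun y => f y + g y) x = pderiv i f x + pderiv i g x := by
  simp [pderiv, fderiv_fun_add hf hg]

theorem pderiv_sub (i : ι) (hf : DifferentiableAt ℝ f x) (hg : DifferentiableAt ℝ g x) :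
    pderiv i (fun y => f y - g y) x = pderiv i f x - pderiv i g x := by
  simp [pderiv, fderiv_fun_sub hf hg]

theorem pderiv_neg (i : ι) (f : (ι → ℝ) → ℝ) (x : ι → ℝ) :
    pderiv i (fun y => -f y) x = -pderiv i f x := by
  simp [pderiv, fderiv_fun_neg]

theorem pderiv_mul (i : ι) (hf : DifferentiableAt ℝ f x) (hg : DifferentiableAt ℝ g x) :
    pderiv i (fun y => f y * g y) x = pderiv i f x * g x + f x * pderiv i g x := by
  simp [pderiv, fderiv_fun_mul hf hg]
  ring

theorem pderiv_div (i : ι) (hf : DifferentiableAt ℝ f x) (hg : DifferentiableAt ℝ g x)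
    (h0 : g x ≠ 0) :
    pderiv i (fun y => f y / g y) x = (pderiv i f x * g x - f x * pderiv i g x) / g x ^ 2 := by
  have h := hf.hasFDerivAt.mul ((hasDerivAt_inv h0).comp_hasFDerivAt x hg.hasFDerivAt)
  have e : (fun y => f y / g y) = f * ((fun y => y⁻¹) ∘ g) := by
    ext y; exact div_eq_mul_inv _ _
  rw [pderiv, e, h.fderiv]
  simp [pderiv]
  field_simp
  ring

theorem pderiv_pow (i : ι) (n : ℕ) (hf : DifferentiableAt ℝ f x) :
    pderiv i (fun y => f y ^ n) x = n * f x ^ (n - 1) * pderiv i f x := by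
  simp [pderiv, fderiv_fun_pow n hf]

theorem contDiff_pderiv (i : ι) (hf : ContDiff ℝ ∞ f) : ContDiff ℝ ∞ (pderiv i f) :=
  (hf.fderiv_right (m := ∞) (by simp)).clm_apply contDiff_const

/-- Used below to bring all mixed partials to the order with index `0` outermost, so that `ring` can
identify them. -/
theorem pderiv_comm (i j : ι) (hf : ContDiff ℝ ∞ f) :
    pderiv i (pderiv j f) = pderiv j (pderiv i f) := by
  ext x
  have hd : DifferentiableAt ℝ (fderiv ℝ f) x :=
    (hf.fderiv_right (m := ∞) (by simp)).differentiable (by simp) x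
  have key : ∀ k l : ι, pderiv k (pderiv l f) x
      = fderiv ℝ (fderiv ℝ f) x (Pi.single k 1) (Pi.single l 1) := by
    intro k l
    change fderiv ℝ (fun y => fderiv ℝ f y (Pi.single l 1)) x (Pi.single k 1) = _
    rw [fderiv_clm_apply hd (differentiableAt_const _)]
    simp
  rw [key, key]
  exact (hf.contDiffAt.isSymmSndFDerivAt (by simpa using ENat.LEInfty.out)) _ _

end PartialDerivatives

theorem fderiv_eq_pderiv {X : Type*} [NormedAddCommGroup X] [NormedSpace ℝ X]
    (F : (Fin 2 → ℝ) → X) (x w : Fin 2 → ℝ) :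
    fderiv ℝ F x w = w 0 • fderiv ℝ F x (Pi.single 0 1) + w 1 • fderiv ℝ F x (Pi.single 1 1) := by
  have hs : w = w 0 • (Pi.single 0 1 : Fin 2 → ℝ) + w 1 • (Pi.single 1 1 : Fin 2 → ℝ) := by
    ext i; fin_cases i <;> simp
  conv_lhs => rw [hs, map_add, map_smul, map_smul]

/-! ### The hyperbolic plane in the global chart -/

/-- The time coordinate `√(1 + |x|²)` of the point of `ℍ²` above `x`. -/
def height (x : Fin 2 → ℝ) : ℝ := √(1 + x 0 ^ 2 + x 1 ^ 2)

theorem height_pos (x : Fin 2 → ℝ) : 0 < height x := Real.sqrt_pos.2 (by positivity)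

theorem height_ne_zero (x : Fin 2 → ℝ) : height x ≠ 0 := (height_pos x).ne'

theorem height_sq (x : Fin 2 → ℝ) : height x ^ 2 = 1 + x 0 ^ 2 + x 1 ^ 2 :=
  Real.sq_sqrt (by positivity)

theorem contDiff_height : ContDiff ℝ ∞ height :=
  ContDiff.sqrt (by fun_prop) fun x => by positivity

/-- Differentiating `height ^ 2`, a polynomial, avoids differentiating the root. -/
theorem pderiv_height (i : Fin 2) (x : Fin 2 → ℝ) : pderiv i height x = x i / height x := by
  have hs := contDiff_height.differentiableAt_of_infty x
  have h1 : pderiv i (fun y => height y ^ 2) x = 2 * x i := by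
    simp only [height_sq]
    rw [pderiv_add _ (by fun_prop) (by fun_prop), pderiv_add _ (by fun_prop) (by fun_prop),
      pderiv_pow _ _ (by fun_prop), pderiv_pow _ _ (by fun_prop), pderiv_const, pderiv_coord,
      pderiv_coord]
    fin_cases i <;> simp
  rw [pderiv_pow _ _ hs] at h1
  field_simp [height_ne_zero x]
  simp at h1
  linarith

@[simp] theorem toH2_zero (x : Fin 2 → ℝ) : (toH2 x : Mink) 0 = height x := rfl

@[simp] theorem toH2_one (x : Fin 2 → ℝ) : (toH2 x : Mink) 1 = x 0 := rfl

@[simp] theorem toH2_two (x : Fin 2 → ℝ) : (toH2 x : Mink) 2 = x 1 := rfl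

theorem forall_H2 {P : H2 → Prop} : (∀ p, P p) ↔ ∀ x, P (toH2 x) :=
  ⟨fun h x => h _, fun h p => by rw [← toH2_spatial p]; exact h _⟩

section Tangent

variable {x : Fin 2 → ℝ}

/-- Orthogonality to the base point determines the time component; hence computations with tangent
vectors need only the two spatial components. -/
theorem tan_zero (w : Tan (toH2 x)) :
    (w : Mink) 0 = (x 0 * (w : Mink) 1 + x 1 * (w : Mink) 2) / height x := by
  have h := mem_Tan.1 w.2
  have h0 := height_ne_zero x
  simp only [mink, toH2_zero, toH2_one, toH2_two] at h
  field_simp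
  linarith

theorem tan_ext {v w : Tan (toH2 x)} (h1 : (v : Mink) 1 = (w : Mink) 1)
    (h2 : (v : Mink) 2 = (w : Mink) 2) : v = w := by
  apply Subtype.ext
  ext i
  fin_cases i
  · simp only [Fin.zero_eta]
    rw [tan_zero v, tan_zero w, h1, h2]
  · exact h1
  · exact h2

theorem mink_tan (v w : Tan (toH2 x)) :
    mink v w = (v : Mink) 1 * (w : Mink) 1 + (v : Mink) 2 * (w : Mink) 2
      - (x 0 * (v : Mink) 1 + x 1 * (v : Mink) 2) * (x 0 * (w : Mink) 1 + x 1 * (w : Mink) 2)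
        / (1 + x 0 ^ 2 + x 1 ^ 2) := by
  rw [mink, tan_zero v, tan_zero w, ← height_sq]
  have h0 := height_ne_zero x
  field_simp
  ring

/-- The tangent vector with given spatial components. -/
def tanMk (x : Fin 2 → ℝ) (a b : ℝ) : Tan (toH2 x) := (chartTan (toH2 x)).symm ![a, b]

@[simp] theorem tanMk_one (x : Fin 2 → ℝ) (a b : ℝ) : (tanMk x a b : Mink) 1 = a := rfl

@[simp] theorem tanMk_two (x : Fin 2 → ℝ) (a b : ℝ) : (tanMk x a b : Mink) 2 = b := rfl

/-- The trace is invariant under conjugation by the chart, so it can be read off the coordinate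
matrix although `∂₀`, `∂₁` are not orthonormal. -/
theorem trace_tan (f : Tan (toH2 x) →ₗ[ℝ] Tan (toH2 x)) :
    LinearMap.trace ℝ _ f = (f (tanMk x 1 0) : Mink) 1 + (f (tanMk x 0 1) : Mink) 2 := by
  rw [← LinearMap.trace_conj' f (chartTan (toH2 x)),
    LinearMap.trace_eq_matrix_trace ℝ (Pi.basisFun ℝ (Fin 2)), Matrix.trace_fin_two]
  simp only [LinearMap.toMatrix_apply, Pi.basisFun_apply, Pi.basisFun_repr, LinearEquiv.conj_apply,
    LinearMap.comp_apply, LinearEquiv.coe_coe]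
  have e0 : (chartTan (toH2 x)).symm (Pi.single 0 1) = tanMk x 1 0 := by
    rw [tanMk]; congr 1; ext i; fin_cases i <;> simp
  have e1 : (chartTan (toH2 x)).symm (Pi.single 1 1) = tanMk x 0 1 := by
    rw [tanMk]; congr 1; ext i; fin_cases i <;> simp
  rw [e0, e1]
  rfl

theorem J_one (w : Tan (toH2 x)) : (J (toH2 x) w : Mink) 1
    = (x 0 * x 1 * (w : Mink) 1 - (1 + x 0 ^ 2) * (w : Mink) 2) / height x := by
  have h0 := height_ne_zero x
  have h2 := height_sq x
  simp only [J, mcross, LinearMap.coe_mk, AddHom.coe_mk, toH2_zero, toH2_two, Matrix.cons_val_one,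
    Matrix.cons_val_zero]
  rw [tan_zero w]
  field_simp
  rw [h2]; ring

theorem J_two (w : Tan (toH2 x)) : (J (toH2 x) w : Mink) 2
    = ((1 + x 1 ^ 2) * (w : Mink) 1 - x 0 * x 1 * (w : Mink) 2) / height x := by
  have h0 := height_ne_zero x
  have h2 := height_sq x
  simp only [J, mcross, LinearMap.coe_mk, AddHom.coe_mk, toH2_zero, toH2_one, Matrix.cons_val]
  rw [tan_zero w]
  field_simp
  rw [h2]; ring

theorem dH_toH2 {X : Type*} [NormedAddCommGroup X] [NormedSpace ℝ X] (F : H2 → X)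
    (w : Tan (toH2 x)) : dH F (toH2 x) w = (w : Mink) 1 • fderiv ℝ (F ∘ toH2) x (Pi.single 0 1)
      + (w : Mink) 2 • fderiv ℝ (F ∘ toH2) x (Pi.single 1 1) := by
  change fderiv ℝ (F ∘ toH2) (spatial (toH2 x)) (spatial w) = _
  rw [spatial_toH2, fderiv_eq_pderiv]
  rfl

theorem grad_one (u : H2 → ℝ) (x : Fin 2 → ℝ) : (grad u (toH2 x) : Mink) 1
    = pderiv 0 (u ∘ toH2) x
      + x 0 * (x 0 * pderiv 0 (u ∘ toH2) x + x 1 * pderiv 1 (u ∘ toH2) x) := by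
  simp only [grad, projT, mink, spatial_toH2, pderiv, LinearMap.coe_mk, AddHom.coe_mk,
    Pi.add_apply, Pi.smul_apply, smul_eq_mul, toH2_zero, toH2_one, toH2_two, Matrix.cons_val]
  ring

theorem grad_two (u : H2 → ℝ) (x : Fin 2 → ℝ) : (grad u (toH2 x) : Mink) 2
    = pderiv 1 (u ∘ toH2) x
      + x 1 * (x 0 * pderiv 0 (u ∘ toH2) x + x 1 * pderiv 1 (u ∘ toH2) x) := by
  simp only [grad, projT, mink, spatial_toH2, pderiv, LinearMap.coe_mk, AddHom.coe_mk,
    Pi.add_apply, Pi.smul_apply, smul_eq_mul, toH2_zero, toH2_one, toH2_two, Matrix.cons_val]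
  ring

end Tangent

/-- The spatial components of a vector field in the global chart. -/
def VField.comp (Y : VField) (k : Fin 2) (x : Fin 2 → ℝ) : ℝ := (Y (toH2 x) : Mink) k.succ

theorem VField.one_eq_comp (Y : VField) (x : Fin 2 → ℝ) : (Y (toH2 x) : Mink) 1 = Y.comp 0 x := rfl

theorem VField.two_eq_comp (Y : VField) (x : Fin 2 → ℝ) : (Y (toH2 x) : Mink) 2 = Y.comp 1 x := rfl

theorem smoothVField_iff {Y : VField} : SmoothVField Y ↔ ∀ k, ContDiff ℝ ∞ (Y.comp k) := by
  constructor
  · intro h k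
    exact contDiff_pi.1 (show ContDiff ℝ ∞ (Y.amb ∘ toH2) from h) k.succ
  · intro h
    change ContDiff ℝ ∞ (Y.amb ∘ toH2)
    refine contDiff_pi.2 fun i => ?_
    refine Fin.cases ?_ (fun k => h k) i
    have e : (fun x => (Y.amb ∘ toH2) x 0)
        = fun x => (x 0 * Y.comp 0 x + x 1 * Y.comp 1 x) / height x := by
      ext x; exact tan_zero _
    rw [e]
    have h0 := h 0
    have h1 := h 1
    exact ContDiff.div (by fun_prop) contDiff_height height_ne_zero

theorem SmoothVField.comp {Y : VField} (h : SmoothVField Y) (k : Fin 2) : ContDiff ℝ ∞ (Y.comp k) :=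
  smoothVField_iff.1 h k

theorem dH_amb_succ {Y : VField} (hY : SmoothVField Y) (k : Fin 2) (x : Fin 2 → ℝ)
    (w : Tan (toH2 x)) : dH Y.amb (toH2 x) w k.succ
      = (w : Mink) 1 * pderiv 0 (Y.comp k) x + (w : Mink) 2 * pderiv 1 (Y.comp k) x := by
  have h := hasFDerivAt_pi'.1 (hY.hasFDerivAt x) k.succ
  have e : fderiv ℝ (Y.comp k) x
      = (ContinuousLinearMap.proj k.succ).comp (fderiv ℝ (Y.amb ∘ toH2) x) := h.fderiv
  rw [dH_toH2, pderiv, pderiv, e]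
  simp

/-- Differentiating `⟨p, Y⟩ = 0` turns the normal correction `⟨p, dY(w)⟩ p` into `-⟨w, Y⟩ p`. This
amounts to Christoffel symbols `-g_ij x_k`. -/
theorem nabla_succ {Y : VField} (hY : SmoothVField Y) (k : Fin 2) (x : Fin 2 → ℝ)
    (w : Tan (toH2 x)) : (nabla Y (toH2 x) w : Mink) k.succ
      = (w : Mink) 1 * pderiv 0 (Y.comp k) x + (w : Mink) 2 * pderiv 1 (Y.comp k) x
        - mink w (Y (toH2 x)) * x k := by
  have h := mink_dH hY (toH2 x) w
  have e : (toH2 x : Mink) k.succ = x k := by fin_cases k <;> rfl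
  rw [← dH_amb_succ hY, show mink w (Y (toH2 x)) = - mink (toH2 x) (dH Y.amb (toH2 x) w) by linarith]
  simp [nabla, projT, e]

theorem nabla_one {Y : VField} (hY : SmoothVField Y) (x : Fin 2 → ℝ)
    (w : Tan (toH2 x)) : (nabla Y (toH2 x) w : Mink) 1
      = (w : Mink) 1 * pderiv 0 (Y.comp 0) x + (w : Mink) 2 * pderiv 1 (Y.comp 0) x
        - mink w (Y (toH2 x)) * x 0 := nabla_succ hY 0 x w

theorem nabla_two {Y : VField} (hY : SmoothVField Y) (x : Fin 2 → ℝ)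
    (w : Tan (toH2 x)) : (nabla Y (toH2 x) w : Mink) 2
      = (w : Mink) 1 * pderiv 0 (Y.comp 1) x + (w : Mink) 2 * pderiv 1 (Y.comp 1) x
        - mink w (Y (toH2 x)) * x 1 := nabla_succ hY 1 x w

@[fun_prop]
theorem differentiableAt_pderiv {ι : Type*} [Fintype ι] [DecidableEq ι] {f : (ι → ℝ) → ℝ} (i : ι)
    (hf : ContDiff ℝ ∞ f) (x : ι → ℝ) : DifferentiableAt ℝ (pderiv i f) x :=
  (contDiff_pderiv i hf).differentiableAt_of_infty x

@[fun_prop]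
theorem differentiableAt_height (x : Fin 2 → ℝ) : DifferentiableAt ℝ height x :=
  contDiff_height.differentiableAt_of_infty x

/-! ### Lagrangian sections, divergence and stream functions. -/

theorem tan_apply {x : Fin 2 → ℝ} (f : Tan (toH2 x) →ₗ[ℝ] Tan (toH2 x)) (w : Tan (toH2 x))
    (i : Fin 3) : (f w : Mink) i = (w : Mink) 1 * (f (tanMk x 1 0) : Mink) i
      + (w : Mink) 2 * (f (tanMk x 0 1) : Mink) i := by
  have e : w = (w : Mink) 1 • tanMk x 1 0 + (w : Mink) 2 • tanMk x 0 1 := by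
    apply tan_ext <;> simp
  conv_lhs => rw [e, map_add, map_smul, map_smul]
  simp

/-- With the area form `ω(X, Y) = g(JX, Y)`, this is `ω(X, AY) + ω(AX, Y) = tr(A) ω(X, Y)`, valid
for any endomorphism of a plane. -/
theorem mink_J_sub {x : Fin 2 → ℝ} (A : Tan (toH2 x) →ₗ[ℝ] Tan (toH2 x)) (X Y : Tan (toH2 x)) :
    mink (J (toH2 x) X) (A Y) - mink (A X) (J (toH2 x) Y)
      = LinearMap.trace ℝ _ A * mink (J (toH2 x) X) Y := by
  have h0 := height_ne_zero x
  rw [trace_tan, mink_tan, mink_tan, mink_tan, J_one, J_two, J_one, J_two, tan_apply A X,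
    tan_apply A X, tan_apply A Y, tan_apply A Y]
  field_simp
  ring

theorem splitT_symm_dSection {V : VField} (hV : SmoothVField V) (p : H2) (X : Tan p) :
    (splitT p (V p)).symm (dSection V p X) = (X, nabla V p X) := by
  have h := dSection_coe hV p X
  change ((⟨(dSection V p X).1.1, _⟩ : Tan p), projT p (dSection V p X).1.2) = _
  refine Prod.ext (Subtype.ext ?_) ?_
  · simp [h]
  · simp [h, nabla]

/-- By `mink_J_sub` with `A = ∇V`, the pulled-back form is `tr(∇V)` times the area form, which
vanishes nowhere. -/
theorem isLagrangian_iff {V : VField} (hV : SmoothVField V) :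
    IsLagrangian V ↔ ∀ p, LinearMap.trace ℝ (Tan p) (nabla V p) = 0 := by
  rw [IsLagrangian, forall_H2, forall_H2]
  refine forall_congr' fun x => ?_
  simp only [bigOmega, splitT_symm_dSection hV, mink_J_sub]
  refine ⟨fun h => ?_, fun h X Y => by rw [h, zero_mul]⟩
  have := h (tanMk x 1 0) (tanMk x 0 1)
  rcases mul_eq_zero.1 this with h | h
  · exact h
  -- Here `g(J ∂₀, ∂₁) = 1 / height x`, the area density, which is not zero.
  · rw [mink_tan, J_one, J_two] at h
    simp at h
    have h0 := height_ne_zero x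
    field_simp at h
    nlinarith [sq_nonneg (x 0), sq_nonneg (x 1)]

/-- This is the divergence `h ∂_k (V^k / h)` for the area density `1 / h`. -/
theorem trace_nabla {V : VField} (hV : SmoothVField V) (x : Fin 2 → ℝ) :
    LinearMap.trace ℝ _ (nabla V (toH2 x)) = pderiv 0 (V.comp 0) x + pderiv 1 (V.comp 1) x
      - (x 0 * V.comp 0 x + x 1 * V.comp 1 x) / (1 + x 0 ^ 2 + x 1 ^ 2) := by
  rw [trace_tan, nabla_one hV, nabla_two hV, mink_tan, mink_tan]
  simp only [tanMk_one, tanMk_two, V.one_eq_comp, V.two_eq_comp]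
  field_simp
  ring

/-- In the chart, `J grad u` is the Hamiltonian field of `u` for the area form `dx₀ dx₁ / h`; only
first partials of `u` and the factor `h` remain. -/
theorem eq_J_grad_iff {V : VField} {u : H2 → ℝ} : (∀ p, V p = J p (grad u p)) ↔
    ∀ x, V.comp 0 x = -(height x * pderiv 1 (u ∘ toH2) x)
      ∧ V.comp 1 x = height x * pderiv 0 (u ∘ toH2) x := by
  rw [forall_H2]
  refine forall_congr' fun x => ?_
  have h0 := height_ne_zero x
  have h2 := height_sq x
  have e1 : (J (toH2 x) (grad u (toH2 x)) : Mink) 1 = -(height x * pderiv 1 (u ∘ toH2) x) := by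
    rw [J_one, grad_one, grad_two]
    field_simp
    rw [h2]; ring
  have e2 : (J (toH2 x) (grad u (toH2 x)) : Mink) 2 = height x * pderiv 0 (u ∘ toH2) x := by
    rw [J_two, grad_one, grad_two]
    field_simp
    rw [h2]; ring
  rw [← e1, ← e2]
  exact ⟨fun h => by rw [← h]; exact ⟨rfl, rfl⟩, fun h => tan_ext h.1 h.2⟩

/-- Poincaré lemma for the 1-form `θ = a dx₀ + b dx₁` on the plane; the hypothesis says that `dθ =
0`. -/
theorem exists_pderiv_eq {a b : (Fin 2 → ℝ) → ℝ} (ha : ContDiff ℝ ∞ a) (hb : ContDiff ℝ ∞ b)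
    (h : ∀ x, pderiv 1 a x = pderiv 0 b x) :
    ∃ f : (Fin 2 → ℝ) → ℝ, ContDiff ℝ ∞ f ∧ pderiv 0 f = a ∧ pderiv 1 f = b := by
  let π (i : Fin 2) : (Fin 2 → ℝ) →L[ℝ] ℝ := ContinuousLinearMap.proj i
  let θ : (Fin 2 → ℝ) → (Fin 2 → ℝ) →L[ℝ] ℝ := fun x => a x • π 0 + b x • π 1
  have hθ : ContDiff ℝ ∞ θ := (ha.smul contDiff_const).add (hb.smul contDiff_const)
  have hd : ∀ x v w, fderiv ℝ θ x v w
      = (v 0 * pderiv 0 a x + v 1 * pderiv 1 a x) * w 0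
        + (v 0 * pderiv 0 b x + v 1 * pderiv 1 b x) * w 1 := by
    intro x v w
    have h1 := ((ha.differentiableAt_of_infty x).hasFDerivAt.smul_const (π 0)).add
      ((hb.differentiableAt_of_infty x).hasFDerivAt.smul_const (π 1))
    rw [show fderiv ℝ θ x = _ from h1.fderiv]
    simp only [add_apply, ContinuousLinearMap.smulRight_apply,
      smul_apply, fderiv_eq_pderiv a x v, fderiv_eq_pderiv b x v]
    rfl
  obtain ⟨f, hf⟩ := convex_univ.exists_forall_hasFDerivAt_of_fderiv_symmetric isOpen_univ
    (hθ.differentiable (by simp)).differentiableOn (fun x _ v w => by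
      rw [hd, hd]; have := h x; rw [this]; ring)
  have hf' : fderiv ℝ f = θ := funext fun x => (hf x trivial).fderiv
  refine ⟨f, ?_, ?_, ?_⟩
  · rw [contDiff_infty_iff_fderiv, hf']
    exact ⟨fun x => (hf x trivial).differentiableAt, hθ⟩
  · ext x; rw [pderiv, hf']; simp [θ, π]
  · ext x; rw [pderiv, hf']; simp [θ, π]

theorem exists_eq_J_grad {V : VField} (hV : SmoothVField V)
    (h : ∀ p, LinearMap.trace ℝ (Tan p) (nabla V p) = 0) :
    ∃ u : H2 → ℝ, SmoothH2 u ∧ ∀ p, V p = J p (grad u p) := by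
  have hV0 := hV.comp 0
  have hV1 := hV.comp 1
  have d0 := hV0.differentiableAt_of_infty
  have d1 := hV1.differentiableAt_of_infty
  -- The form is obtained by solving `eq_J_grad_iff` for the partials of `u`; it is closed exactly
  -- when the divergence of `V` vanishes.
  obtain ⟨f, hf, h0, h1⟩ := exists_pderiv_eq
    (a := fun x => V.comp 1 x / height x) (b := fun x => -(V.comp 0 x / height x))
    (hV1.div contDiff_height height_ne_zero) (hV0.div contDiff_height height_ne_zero).neg
    (fun x => by
      have hx := h (toH2 x)
      have hs := height_ne_zero x
      rw [trace_nabla hV, ← height_sq] at hx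
      rw [pderiv_neg, pderiv_div _ (d1 x) (by fun_prop) hs, pderiv_div _ (d0 x) (by fun_prop) hs,
        pderiv_height, pderiv_height]
      field_simp at hx ⊢
      linear_combination hx)
  have e : (fun p : H2 => f (spatial p)) ∘ toH2 = f := by
    ext x; simp [spatial_toH2]
  refine ⟨fun p => f (spatial p), ?_, ?_⟩
  · rw [SmoothH2, e]; exact hf
  · rw [eq_J_grad_iff, e, h0, h1]
    intro x
    have hs := height_ne_zero x
    constructor <;> field_simp

/-! ### Gradient, Hessian and Laplacian in the chart. -/

theorem smooth_grad {u : H2 → ℝ} (hu : SmoothH2 u) : SmoothVField (grad u) := by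
  have hf : ContDiff ℝ ∞ (u ∘ toH2) := hu
  have h0 := contDiff_pderiv 0 hf
  have h1 := contDiff_pderiv 1 hf
  rw [smoothVField_iff]
  intro k
  fin_cases k
  · change ContDiff ℝ ∞ ((grad u).comp 0)
    rw [show (grad u).comp 0 = _ from funext fun x => grad_one u x]
    fun_prop
  · change ContDiff ℝ ∞ ((grad u).comp 1)
    rw [show (grad u).comp 1 = _ from funext fun x => grad_two u x]
    fun_prop

/-- The connection term is `⟨w, grad u⟩ x_k = du(w) x_k`; it cancels one product-rule term and
leaves polynomial coefficients. -/
theorem hess_one {u : H2 → ℝ} (hu : SmoothH2 u) (x : Fin 2 → ℝ) (w : Tan (toH2 x)) :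
    (hess u (toH2 x) w : Mink) 1 =
      (w : Mink) 1 * (x 0 * pderiv 0 (u ∘ toH2) x + x 1 * pderiv 1 (u ∘ toH2) x
        + (1 + x 0 ^ 2) * pderiv 0 (pderiv 0 (u ∘ toH2)) x
        + x 0 * x 1 * pderiv 0 (pderiv 1 (u ∘ toH2)) x)
      + (w : Mink) 2 * ((1 + x 0 ^ 2) * pderiv 0 (pderiv 1 (u ∘ toH2)) x
        + x 0 * x 1 * pderiv 1 (pderiv 1 (u ∘ toH2)) x) := by
  have hf : ContDiff ℝ ∞ (u ∘ toH2) := hu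
  rw [hess, nabla_one (smooth_grad hu), mink_tan, grad_one, grad_two,
    show (grad u).comp 0 = _ from funext fun x => grad_one u x]
  simp (disch := fun_prop) only [pderiv_add, pderiv_mul, pderiv_coord]
  rw [pderiv_comm 1 0 hf]
  simp
  field_simp
  ring

theorem hess_two {u : H2 → ℝ} (hu : SmoothH2 u) (x : Fin 2 → ℝ) (w : Tan (toH2 x)) :
    (hess u (toH2 x) w : Mink) 2 =
      (w : Mink) 1 * ((1 + x 1 ^ 2) * pderiv 0 (pderiv 1 (u ∘ toH2)) x
        + x 0 * x 1 * pderiv 0 (pderiv 0 (u ∘ toH2)) x)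
      + (w : Mink) 2 * (x 0 * pderiv 0 (u ∘ toH2) x + x 1 * pderiv 1 (u ∘ toH2) x
        + (1 + x 1 ^ 2) * pderiv 1 (pderiv 1 (u ∘ toH2)) x
        + x 0 * x 1 * pderiv 0 (pderiv 1 (u ∘ toH2)) x) := by
  have hf : ContDiff ℝ ∞ (u ∘ toH2) := hu
  rw [hess, nabla_two (smooth_grad hu), mink_tan, grad_one, grad_two,
    show (grad u).comp 1 = _ from funext fun x => grad_two u x]
  simp (disch := fun_prop) only [pderiv_add, pderiv_mul, pderiv_coord]
  rw [pderiv_comm 1 0 hf]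
  simp
  field_simp
  ring

theorem hess_symm {u : H2 → ℝ} (hu : SmoothH2 u) : Tensor11.SelfAdjoint (hess u) := by
  rw [Tensor11.SelfAdjoint, forall_H2]
  intro x v w
  rw [mink_tan, mink_tan, hess_one hu, hess_two hu, hess_one hu, hess_two hu]
  field_simp
  ring

/-- The operator `Δ` in the global chart. -/
theorem laplacian_toH2 {u : H2 → ℝ} (hu : SmoothH2 u) (x : Fin 2 → ℝ) :
    laplacian u (toH2 x) = (1 + x 0 ^ 2) * pderiv 0 (pderiv 0 (u ∘ toH2)) x
      + 2 * (x 0 * x 1) * pderiv 0 (pderiv 1 (u ∘ toH2)) x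
      + (1 + x 1 ^ 2) * pderiv 1 (pderiv 1 (u ∘ toH2)) x
      + 2 * (x 0 * pderiv 0 (u ∘ toH2) x + x 1 * pderiv 1 (u ∘ toH2) x) := by
  rw [laplacian, trace_tan, hess_one hu, hess_two hu]
  simp only [tanMk_one, tanMk_two]
  ring

/-! ### Graphs in Half-Pipe space -/

/-- The metric induced on the tangent planes is positive definite, so testing with `w = v` is
enough. -/
theorem tan_eq_zero_of_mink {p : H2} {v : Tan p} (h : ∀ w : Tan p, mink v w = 0) : v = 0 := by
  obtain ⟨x, rfl⟩ : ∃ x, p = toH2 x := ⟨spatial p, (toH2_spatial p).symm⟩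
  have h1 := h v
  rw [mink_tan] at h1
  have hD : (0 : ℝ) < 1 + x 0 ^ 2 + x 1 ^ 2 := by positivity
  field_simp at h1
  -- Lagrange's identity: `(1 + |x|²) g(v, v) = |v|² + (x₀ v₂ - x₁ v₁)²`, with `|v|² = v₁² + v₂²`.
  have h2 : (v : Mink) 1 = 0 := by
    nlinarith [sq_nonneg (x 0 * (v : Mink) 2 - x 1 * (v : Mink) 1), sq_nonneg ((v : Mink) 1),
      sq_nonneg ((v : Mink) 2)]
  have h3 : (v : Mink) 2 = 0 := by
    nlinarith [sq_nonneg (x 0 * (v : Mink) 2 - x 1 * (v : Mink) 1), sq_nonneg ((v : Mink) 1),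
      sq_nonneg ((v : Mink) 2)]
  exact tan_ext h2 h3

theorem tan_eq_of_mink {p : H2} {v v' : Tan p} (h : ∀ w : Tan p, mink v w = mink v' w) :
    v = v' := by
  rw [← sub_eq_zero]
  refine tan_eq_zero_of_mink fun w => ?_
  have := h w
  simp only [mink, Submodule.coe_sub, Pi.sub_apply] at *
  linarith

/-- The extension has constant components in the global chart. It is needed because
`IsSecondFundamentalForm` is tested on fields, not on vectors. -/
theorem exists_smooth_extension {p : H2} (w : Tan p) :
    ∃ Y : VField, SmoothVField Y ∧ Y p = w := by
  refine ⟨fun q => (chartTan q).symm (chartTan p w), ?_, (chartTan p).symm_apply_apply w⟩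
  rw [smoothVField_iff]
  intro k
  have : VField.comp (fun q => (chartTan q).symm (chartTan p w)) k = fun _ => chartTan p w k := by
    ext x
    fin_cases k <;> rfl
  rw [this]
  exact contDiff_const

theorem trace_id (p : H2) : LinearMap.trace ℝ (Tan p) LinearMap.id = 2 := by
  obtain ⟨x, rfl⟩ : ∃ x, p = toH2 x := ⟨spatial p, (toH2_spatial p).symm⟩
  rw [trace_tan]
  norm_num

/-- The shape operator `Hess u - u` of the graph of `u`. -/
def graphShape (u : H2 → ℝ) : Tensor11 := fun p => hess u p - u p • LinearMap.id

theorem trace_graphShape (u : H2 → ℝ) (p : H2) :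
    LinearMap.trace ℝ (Tan p) (graphShape u p) = laplacian u p - 2 * u p := by
  have h := (LinearMap.trace ℝ (Tan p)).map_sub (hess u p) (u p • LinearMap.id)
  rw [LinearMap.map_smul, trace_id, smul_eq_mul, mul_comm] at h
  exact h

theorem mink_graphShape (u : H2 → ℝ) (p : H2) (v w : Tan p) :
    mink (graphShape u p v) w = mink (hess u p v) w - u p * mink v w := by
  simp [graphShape, mink]
  ring

/-- The lift of `Y` is `(Y, g(grad u, Y))`. The first component of its derivative gives `∇_v Y`. By
metric compatibility the second gives `g(Hess u v, Y) + du(∇_v Y)`, and the normal term subtracts `u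
g(v, Y)`: this is where `Hess u - u` comes from. -/
theorem hpNabla_graphLift {u : H2 → ℝ} (hu : SmoothH2 u) (p : H2) (v : Tan p) {Y : VField}
    (hY : SmoothVField Y) : hpNabla u (fun q => graphLift u q (Y q)) p v
      = graphLift u p (nabla Y p v) + mink (graphShape u p v) (Y p) • ((0 : Mink), (1 : ℝ)) := by
  have hg := smooth_grad hu
  have e : (fun q => graphLift u q (Y q)) = fun q => (Y.amb q, mink (grad u q) (Y q)) := by
    ext1 q
    simp [graphLift, VField.amb, mink_grad]
  obtain ⟨m, hm, -⟩ :=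
    hasFDerivAt_mink_comp (hg.hasFDerivAt (spatial p)) (hY.hasFDerivAt (spatial p))
  have hd : dH (fun q => (Y.amb q, mink (grad u q) (Y q))) p v
      = (dH Y.amb p v, dH (fun q => mink (grad u q) (Y q)) p v) := by
    have h1 := (hY.hasFDerivAt (spatial p)).prodMk hm
    change fderiv ℝ (fun x => ((Y.amb ∘ toH2) x, mink (((grad u).amb ∘ toH2) x) ((Y.amb ∘ toH2) x)))
      (spatial p) (spatial v) = (fderiv ℝ (Y.amb ∘ toH2) (spatial p) (spatial v),
        fderiv ℝ (fun x => mink (((grad u).amb ∘ toH2) x) ((Y.amb ∘ toH2) x)) (spatial p) (spatial v))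
    rw [h1.fderiv, hm.fderiv]
    rfl
  have h2 := mink_dH hY p v
  rw [hpNabla, e, hd, nabla_metric hg hY, mink_graphShape]
  refine Prod.ext ?_ ?_
  · have : mink p (dH Y.amb p v) = -mink v (Y p) := by linarith
    simp [graphLift, nabla, projT, this, sub_eq_add_neg]
  · simp only [graphLift, Prod.snd_add, Prod.snd_sub, Prod.smul_snd, ← mink_grad, hess, smul_eq_mul]
    ring

theorem isShapeOperator_graphShape {u : H2 → ℝ} (hu : SmoothH2 u) :
    IsShapeOperator u (graphShape u) := by
  refine ⟨fun p v w => ?_, fun p v Y hY => hpNabla_graphLift hu p v hY⟩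
  rw [mink_graphShape, mink_comm v (graphShape u p w), mink_graphShape, hess_symm hu,
    mink_comm v, mink_comm v]

/-- `IsMeanGraph` only asserts that some trace-free shape operator exists; uniqueness turns this
into a statement about `graphShape u`. -/
theorem IsShapeOperator.eq_graphShape {u : H2 → ℝ} (hu : SmoothH2 u) {B : Tensor11}
    (hB : IsShapeOperator u B) : B = graphShape u := by
  funext p
  refine LinearMap.ext fun v => tan_eq_of_mink fun w => ?_
  obtain ⟨Y, hY, rfl⟩ := exists_smooth_extension w
  have h := hB.2 p v Y hY
  rw [hpNabla_graphLift hu p v hY, add_right_inj] at h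
  simpa using (congrArg Prod.snd h).symm

theorem isMeanGraph_iff {u : H2 → ℝ} (hu : SmoothH2 u) :
    IsMeanGraph u ↔ ∀ p, laplacian u p - 2 * u p = 0 := by
  constructor
  · rintro ⟨B, hB, h⟩ p
    rw [← trace_graphShape, ← hB.eq_graphShape hu, h]
  · intro h
    exact ⟨graphShape u, isShapeOperator_graphShape hu, fun p => by rw [trace_graphShape, h]⟩

/-! ### The associated vector field -/

theorem radial_toH2 (y : Fin 2 → ℝ) (i : Fin 2) : radial (toH2 y) i = y i / height y := by
  fin_cases i <;> rfl

theorem radial_mem_kleinDisk (y : Fin 2 → ℝ) : radial (toH2 y) ∈ kleinDisk := by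
  have h := height_sq y
  have h0 := height_pos y
  change radial (toH2 y) 0 ^ 2 + radial (toH2 y) 1 ^ 2 < 1
  rw [radial_toH2, radial_toH2, div_pow, div_pow, ← add_div, div_lt_one (by positivity)]
  linarith

theorem kleinFun_radial (u : H2 → ℝ) (y : Fin 2 → ℝ) :
    kleinFun u (radial (toH2 y)) = u (toH2 y) / height y := by
  have h := height_sq y
  have h0 := height_pos y
  rw [kleinFun, kleinInv_radial, radial_toH2, radial_toH2,
    show 1 - (y 0 / height y) ^ 2 - (y 1 / height y) ^ 2 = ((height y)⁻¹) ^ 2 by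
      field_simp; linarith, Real.sqrt_sq (by positivity)]
  ring

theorem differentiableAt_kleinFun {u : H2 → ℝ} (hu : SmoothH2 u) {η : Fin 2 → ℝ}
    (hη : η ∈ kleinDisk) : DifferentiableAt ℝ (kleinFun u) η := by
  have h : η 0 ^ 2 + η 1 ^ 2 < 1 := hη
  have hs : DifferentiableAt ℝ (fun η : Fin 2 → ℝ => √(1 - η 0 ^ 2 - η 1 ^ 2)) η :=
    DifferentiableAt.sqrt (by fun_prop) (by linarith)
  have hs0 : √(1 - η 0 ^ 2 - η 1 ^ 2) ≠ 0 := (Real.sqrt_pos.2 (by linarith)).ne'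
  have hf : ContDiff ℝ ∞ (u ∘ toH2) := hu
  refine hs.mul ?_
  exact DifferentiableAt.comp (g := u ∘ toH2)
    (f := fun η : Fin 2 → ℝ => (√(1 - η 0 ^ 2 - η 1 ^ 2))⁻¹ • η) η
    (hf.differentiableAt_of_infty _) ((hs.inv hs0).smul differentiableAt_id)

/-- Differentiating `kleinFun u (y / h) = u / h` gives a linear system for the two partials, whose
matrix `g / h` is the Jacobian of `y ↦ y / h`. -/
theorem pderiv_kleinFun {u : H2 → ℝ} (hu : SmoothH2 u) (x : Fin 2 → ℝ) (i : Fin 2) :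
    pderiv i (kleinFun u) (radial (toH2 x)) = pderiv i (u ∘ toH2) x
      + x i * (x 0 * pderiv 0 (u ∘ toH2) x + x 1 * pderiv 1 (u ∘ toH2) x - u (toH2 x)) := by
  have hf : ContDiff ℝ ∞ (u ∘ toH2) := hu
  have hs := height_ne_zero x
  have hR : ∀ k : Fin 2, DifferentiableAt ℝ (fun y => radial (toH2 y) k) x := by
    intro k
    simp only [radial_toH2, div_eq_mul_inv]
    exact (differentiableAt_apply k x).mul ((differentiableAt_height x).inv hs)
  have key : ∀ j : Fin 2, pderiv j (fun y => (u ∘ toH2) y / height y) x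
      = pderiv j (fun y => radial (toH2 y) 0) x * pderiv 0 (kleinFun u) (radial (toH2 x))
        + pderiv j (fun y => radial (toH2 y) 1) x * pderiv 1 (kleinFun u) (radial (toH2 x)) := by
    intro j
    have h1 := (differentiableAt_kleinFun hu (radial_mem_kleinDisk x)).hasFDerivAt.comp x
      (hasFDerivAt_pi.2 fun k => (hR k).hasFDerivAt)
    have e : (fun y => (u ∘ toH2) y / height y) = kleinFun u ∘ fun y k => radial (toH2 y) k := by
      ext y; exact (kleinFun_radial u y).symm
    rw [pderiv, e, h1.fderiv, ContinuousLinearMap.comp_apply, fderiv_eq_pderiv]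
    rfl
  have k0 := key 0
  have k1 := key 1
  have hd := hf.differentiableAt_of_infty x
  have h2 := height_sq x
  simp (disch := first | fun_prop | exact hs) only [radial_toH2, pderiv_div, pderiv_coord,
    pderiv_height] at k0 k1
  simp only [Function.comp_apply] at k0 k1
  simp at k0 k1
  field_simp at k0 k1
  rw [h2] at k0 k1
  -- The system is solved with the rows of the inverse metric `δ_ij + x_i x_j`.
  have hD : 1 + x 0 ^ 2 + x 1 ^ 2 ≠ 0 := by positivity
  apply mul_left_cancel₀ hD
  fin_cases i
  · simp only [Fin.zero_eta]
    linear_combination -(1 + x 0 ^ 2) * k0 - x 0 * x 1 * k1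
  · simp only [Fin.mk_one]
    linear_combination -(1 + x 1 ^ 2) * k1 - x 0 * x 1 * k0

/-- Both planes are graphs of affine functions over the disk. They coincide exactly when the
coefficients agree, and these determine all three components of `σ`. -/
theorem tangentPlane_eq_dualPlane_iff {u : H2 → ℝ} (hu : SmoothH2 u) (p : H2) (σ : Mink) :
    tangentPlane u p = dualPlane σ ↔ σ = grad u p - u p • (p : Mink) := by
  obtain ⟨x, rfl⟩ : ∃ x, p = toH2 x := ⟨spatial p, (toH2_spatial p).symm⟩
  have hs := height_ne_zero x
  have h2 := height_sq x
  -- The formula for `σ` is equivalent to matching the constant term `⟨(1, 0, 0), σ⟩ = -σ₀` and the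
  -- two slopes.
  have hσ : σ = grad u (toH2 x) - u (toH2 x) • (toH2 x : Mink) ↔
      mink ![1, 0, 0] σ = kleinFun u (radial (toH2 x))
          - fderiv ℝ (kleinFun u) (radial (toH2 x)) (radial (toH2 x))
        ∧ σ 1 = pderiv 0 (kleinFun u) (radial (toH2 x))
        ∧ σ 2 = pderiv 1 (kleinFun u) (radial (toH2 x)) := by
    rw [fderiv_eq_pderiv, ← pderiv, ← pderiv, pderiv_kleinFun hu, pderiv_kleinFun hu,
      kleinFun_radial, radial_toH2, radial_toH2, funext_iff, Fin.forall_fin_succ,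
      Fin.forall_fin_two]
    simp only [Pi.sub_apply, Pi.smul_apply, smul_eq_mul, Fin.succ_zero_eq_one, Fin.succ_one_eq_two,
      tan_zero, grad_one, grad_two, toH2_zero, toH2_one, toH2_two]
    simp [mink]
    refine and_congr ?_ (and_congr (Eq.congr_right (by ring)) (Eq.congr_right (by ring)))
    rw [neg_eq_iff_eq_neg]
    refine Eq.congr_right ?_
    field_simp
    rw [h2]
    ring
  rw [hσ]
  have hz : ∀ η : Fin 2 → ℝ, kleinFun u (radial (toH2 x))
        + fderiv ℝ (kleinFun u) (radial (toH2 x)) (η - radial (toH2 x))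
      = kleinFun u (radial (toH2 x))
          - fderiv ℝ (kleinFun u) (radial (toH2 x)) (radial (toH2 x))
        + (η 0 * pderiv 0 (kleinFun u) (radial (toH2 x))
        + η 1 * pderiv 1 (kleinFun u) (radial (toH2 x))) := by
    intro η
    rw [map_sub, fderiv_eq_pderiv _ _ η]
    simp only [pderiv, smul_eq_mul]
    ring
  simp only [tangentPlane, hz]
  generalize kleinFun u (radial (toH2 x))
          - fderiv ℝ (kleinFun u) (radial (toH2 x)) (radial (toH2 x)) = C
  generalize pderiv 0 (kleinFun u) (radial (toH2 x)) = A
  generalize pderiv 1 (kleinFun u) (radial (toH2 x)) = B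
  constructor
  · intro h
    have key : ∀ η ∈ kleinDisk, mink ![1, η 0, η 1] σ = C + (η 0 * A + η 1 * B) := by
      intro η hη
      have : (η, C + (η 0 * A + η 1 * B)) ∈ dualPlane σ := by
        rw [← h]; exact ⟨hη, rfl⟩
      exact this.2
    -- Three affinely independent points of the disk determine an affine function.
    have m0 := key ![0, 0] (by simp [kleinDisk])
    have m1 := key ![1 / 2, 0] (by norm_num [kleinDisk])
    have m2 := key ![0, 1 / 2] (by norm_num [kleinDisk])
    simp [mink] at m0 m1 m2 ⊢
    refine ⟨m0, ?_, ?_⟩ <;> linarith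
  · rintro ⟨h0, h1, h2⟩
    ext ⟨η, t⟩
    refine and_congr_right fun _ => ?_
    simp [mink] at h0 ⊢
    rw [← h0, ← h1, ← h2, eq_comm]
    ring_nf

theorem isAssociatedField_iff {u : H2 → ℝ} (hu : SmoothH2 u) (V : VField) :
    IsAssociatedField u V ↔ ∀ p, V p = J p (grad u p) := by
  refine forall_congr' fun p => ?_
  simp only [tangentPlane_eq_dualPlane_iff hu, exists_eq_left, Subtype.ext_iff]
  -- The component of `σ` along `p` is lost because `p ⊠ p = 0`.
  have : mcross p (grad u p - u p • (p : Mink)) = J p (grad u p) := by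
    simp only [J, LinearMap.coe_mk, AddHom.coe_mk]
    ext i
    fin_cases i <;> simp [mcross] <;> ring
  rw [this]

/-! ### The tensor `b` with `L_V g = g(b ·, ·)` -/

theorem mink_J_left {x : Fin 2 → ℝ} (v w : Tan (toH2 x)) :
    mink (J (toH2 x) v) w = -mink v (J (toH2 x) w) := by
  have h0 := height_ne_zero x
  rw [mink_tan, mink_tan, J_one, J_two, J_one, J_two]
  field_simp
  ring

/-- The hypothesis says that `B` is `A` plus its adjoint, and adjoints have equal traces. -/
theorem trace_eq_of_mink_add {x : Fin 2 → ℝ} {A B : Tan (toH2 x) →ₗ[ℝ] Tan (toH2 x)}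
    (h : ∀ X Y : Tan (toH2 x), mink X (A Y) + mink Y (A X) = mink (B X) Y) :
    LinearMap.trace ℝ _ B = 2 * LinearMap.trace ℝ _ A := by
  have h00 := h (tanMk x 1 0) (tanMk x 1 0)
  have h01 := h (tanMk x 1 0) (tanMk x 0 1)
  have h10 := h (tanMk x 0 1) (tanMk x 1 0)
  have h11 := h (tanMk x 0 1) (tanMk x 0 1)
  rw [trace_tan, trace_tan]
  simp only [mink_tan, tanMk_one, tanMk_two] at h00 h01 h10 h11
  field_simp at h00 h01 h10 h11
  have hD : 1 + x 0 ^ 2 + x 1 ^ 2 ≠ 0 := by positivity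
  apply mul_left_cancel₀ hD
  -- This contracts the hypothesis with the inverse metric.
  linear_combination -(1 + x 0 ^ 2) * h00 - x 0 * x 1 * h01 - x 0 * x 1 * h10 - (1 + x 1 ^ 2) * h11

theorem IsLieTensor.trace_eq {V : VField} {b : Tensor11} (hb : IsLieTensor V b) (p : H2) :
    LinearMap.trace ℝ (Tan p) (b p) = 2 * LinearMap.trace ℝ (Tan p) (nabla V p) := by
  revert p
  rw [forall_H2]
  exact fun x => trace_eq_of_mink_add fun X Y => hb.2.2 (toH2 x) X Y

theorem IsLieTensor.unique {V : VField} {b b' : Tensor11} (hb : IsLieTensor V b)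
    (hb' : IsLieTensor V b') : b' = b := by
  funext p
  refine LinearMap.ext fun v => tan_eq_of_mink fun w => ?_
  rw [← hb.2.2, ← hb'.2.2]

/-! ### Lie tensors of the fields `J grad u`. -/

section PotentialField

variable {V : VField} {u : H2 → ℝ}

/-- This expresses that `J` is parallel, checked in the chart on the single field `grad u`. -/
theorem nabla_J_grad (hV : SmoothVField V) (hu : SmoothH2 u) (h : ∀ p, V p = J p (grad u p))
    (p : H2) : nabla V p = J p ∘ₗ hess u p := by
  have hf : ContDiff ℝ ∞ (u ∘ toH2) := hu
  obtain ⟨x, rfl⟩ : ∃ x, p = toH2 x := ⟨spatial p, (toH2_spatial p).symm⟩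
  have h' := eq_J_grad_iff.1 h
  have hs := height_ne_zero x
  have e0 : V.comp 0 = _ := funext fun y => (h' y).1
  have e1 : V.comp 1 = _ := funext fun y => (h' y).2
  refine LinearMap.ext fun w => ?_
  rw [LinearMap.comp_apply]
  have h2 := height_sq x
  apply tan_ext
  · rw [nabla_one hV, J_one, hess_one hu, hess_two hu, mink_tan, V.one_eq_comp, V.two_eq_comp,
      e0, e1]
    simp (disch := fun_prop) only [pderiv_neg, pderiv_mul, pderiv_height]
    rw [← h2]
    field_simp
    rw [h2]
    ring
  · rw [nabla_two hV, J_two, hess_one hu, hess_two hu, mink_tan, V.one_eq_comp, V.two_eq_comp,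
      e0, e1]
    simp (disch := fun_prop) only [pderiv_mul, pderiv_height]
    rw [pderiv_comm 1 0 hf, ← h2]
    field_simp
    rw [h2]
    ring

/-- The tensor `2 J Hess u - Δu J`, that is, twice `J` applied to the trace-free Hessian. -/
def lieTensor (u : H2 → ℝ) : Tensor11 := fun p =>
  (2 : ℝ) • (J p ∘ₗ hess u p) - laplacian u p • J p

/-- Since `J` is skew and `∇V = J Hess u`, `mink_J_sub` with `A = Hess u` rewrites `g(X, J Hess u
Y)` as `g(J Hess u X, Y) - Δu g(JX, Y)`. -/
theorem lieMetric_J_grad (hV : SmoothVField V) (hu : SmoothH2 u) (h : ∀ p, V p = J p (grad u p))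
    (p : H2) (X Y : Tan p) : lieMetric V p X Y = mink (lieTensor u p X) Y := by
  obtain ⟨x, rfl⟩ : ∃ x, p = toH2 x := ⟨spatial p, (toH2_spatial p).symm⟩
  have h1 := mink_J_sub (hess u (toH2 x)) X Y
  have h2 := mink_J_left X (hess u (toH2 x) Y)
  have h3 := mink_J_left (hess u (toH2 x) X) Y
  have h4 : mink (lieTensor u (toH2 x) X) Y = 2 * mink (J (toH2 x) (hess u (toH2 x) X)) Y
      - laplacian u (toH2 x) * mink (J (toH2 x) X) Y := by
    simp [lieTensor, mink]
    ring
  rw [lieMetric, nabla_J_grad hV hu h, LinearMap.comp_apply, LinearMap.comp_apply, h4,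
    mink_comm Y, laplacian]
  linarith

/-- No first derivative of `u` occurs: in `Hess u` they enter only through a multiple of the
identity, which the trace-free part removes. -/
theorem lieTensor_one (hu : SmoothH2 u) (x : Fin 2 → ℝ) (w : Tan (toH2 x)) :
    (lieTensor u (toH2 x) w : Mink) 1 =
      -((w : Mink) 1 * (x 0 * x 1 * (1 + x 0 ^ 2) * pderiv 0 (pderiv 0 (u ∘ toH2)) x
          + 2 * (1 + x 0 ^ 2) * (1 + x 1 ^ 2) * pderiv 0 (pderiv 1 (u ∘ toH2)) x
          + x 0 * x 1 * (1 + x 1 ^ 2) * pderiv 1 (pderiv 1 (u ∘ toH2)) x) / height x)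
      + (w : Mink) 2 * ((1 + x 0 ^ 2) ^ 2 * pderiv 0 (pderiv 0 (u ∘ toH2)) x
          + 2 * (x 0 * x 1 * (1 + x 0 ^ 2)) * pderiv 0 (pderiv 1 (u ∘ toH2)) x
          + (x 0 ^ 2 * x 1 ^ 2 - 1 - x 0 ^ 2 - x 1 ^ 2) * pderiv 1 (pderiv 1 (u ∘ toH2)) x)
            / height x := by
  have hs := height_ne_zero x
  have : (lieTensor u (toH2 x) w : Mink) 1 = 2 * (J (toH2 x) (hess u (toH2 x) w) : Mink) 1
      - laplacian u (toH2 x) * (J (toH2 x) w : Mink) 1 := by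
    simp [lieTensor]
  rw [this, J_one, J_one, hess_one hu, hess_two hu, laplacian_toH2 hu]
  field_simp
  ring

theorem lieTensor_two (hu : SmoothH2 u) (x : Fin 2 → ℝ) (w : Tan (toH2 x)) :
    (lieTensor u (toH2 x) w : Mink) 2 =
      -((w : Mink) 1 * ((1 + x 1 ^ 2) ^ 2 * pderiv 1 (pderiv 1 (u ∘ toH2)) x
          + 2 * (x 0 * x 1 * (1 + x 1 ^ 2)) * pderiv 0 (pderiv 1 (u ∘ toH2)) x
          + (x 0 ^ 2 * x 1 ^ 2 - 1 - x 0 ^ 2 - x 1 ^ 2) * pderiv 0 (pderiv 0 (u ∘ toH2)) x)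
            / height x)
      + (w : Mink) 2 * (x 0 * x 1 * (1 + x 0 ^ 2) * pderiv 0 (pderiv 0 (u ∘ toH2)) x
          + 2 * (1 + x 0 ^ 2) * (1 + x 1 ^ 2) * pderiv 0 (pderiv 1 (u ∘ toH2)) x
          + x 0 * x 1 * (1 + x 1 ^ 2) * pderiv 1 (pderiv 1 (u ∘ toH2)) x) / height x := by
  have hs := height_ne_zero x
  have : (lieTensor u (toH2 x) w : Mink) 2 = 2 * (J (toH2 x) (hess u (toH2 x) w) : Mink) 2
      - laplacian u (toH2 x) * (J (toH2 x) w : Mink) 2 := by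
    simp [lieTensor]
  rw [this, J_two, J_two, hess_one hu, hess_two hu, laplacian_toH2 hu]
  field_simp
  ring

theorem smooth_lieTensor (hu : SmoothH2 u) : (lieTensor u).Smooth := by
  have hf : ContDiff ℝ ∞ (u ∘ toH2) := hu
  have h00 := contDiff_pderiv 0 (contDiff_pderiv 0 hf)
  have h01 := contDiff_pderiv 0 (contDiff_pderiv 1 hf)
  have h11 := contDiff_pderiv 1 (contDiff_pderiv 1 hf)
  have hs := contDiff_height
  have hs0 := height_ne_zero
  intro Y hY
  have hY0 := hY.comp 0
  have hY1 := hY.comp 1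
  rw [smoothVField_iff, Fin.forall_fin_two]
  constructor
  · rw [show ((lieTensor u).app Y).comp 0 = _ from
      funext fun x => lieTensor_one hu x (Y (toH2 x))]
    simp only [Y.one_eq_comp, Y.two_eq_comp]
    fun_prop (disch := assumption)
  · rw [show ((lieTensor u).app Y).comp 1 = _ from
      funext fun x => lieTensor_two hu x (Y (toH2 x))]
    simp only [Y.one_eq_comp, Y.two_eq_comp]
    fun_prop (disch := assumption)

/-- Self-adjointness is inherited from the symmetry of `lieMetric`. -/
theorem isLieTensor_lieTensor (hV : SmoothVField V) (hu : SmoothH2 u)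
    (h : ∀ p, V p = J p (grad u p)) : IsLieTensor V (lieTensor u) := by
  refine ⟨smooth_lieTensor hu, fun p v w => ?_, lieMetric_J_grad hV hu h⟩
  rw [mink_comm v, ← lieMetric_J_grad hV hu h, ← lieMetric_J_grad hV hu h, lieMetric, lieMetric,
    add_comm]

/-- A skew endomorphism composed with a self-adjoint one has trace zero. -/
theorem trace_nabla_J_grad (hV : SmoothVField V) (hu : SmoothH2 u)
    (h : ∀ p, V p = J p (grad u p)) (p : H2) :
    LinearMap.trace ℝ (Tan p) (nabla V p) = 0 := by
  obtain ⟨x, rfl⟩ : ∃ x, p = toH2 x := ⟨spatial p, (toH2_spatial p).symm⟩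
  rw [nabla_J_grad hV hu h, trace_tan, LinearMap.comp_apply, LinearMap.comp_apply, J_one, J_two,
    hess_one hu, hess_two hu, hess_one hu, hess_two hu]
  have hs := height_ne_zero x
  simp only [tanMk_one, tanMk_two]
  field_simp
  ring

end PotentialField

/-! ### Codazzi tensors in the global chart -/

/-- The coordinate vector fields of the global chart. -/
def coordField (j : Fin 2) : VField := fun p => (chartTan p).symm (Pi.single j 1)

theorem comp_coordField (j k : Fin 2) :
    (coordField j).comp k = fun _ => (Pi.single j 1 : Fin 2 → ℝ) k := by
  ext x
  fin_cases k <;> rfl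

theorem smooth_coordField (j : Fin 2) : SmoothVField (coordField j) := by
  rw [smoothVField_iff]
  intro k
  rw [comp_coordField]
  exact contDiff_const

theorem coordField_zero (x : Fin 2 → ℝ) : coordField 0 (toH2 x) = tanMk x 1 0 :=
  tan_ext (by simp [coordField, chartTan]) (by simp [coordField, chartTan])

theorem coordField_one (x : Fin 2 → ℝ) : coordField 1 (toH2 x) = tanMk x 0 1 :=
  tan_ext (by simp [coordField, chartTan]) (by simp [coordField, chartTan])

theorem comp_app (b : Tensor11) (Y : VField) (k : Fin 2) :
    (b.app Y).comp k = fun x => Y.comp 0 x * (b.app (coordField 0)).comp k x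
      + Y.comp 1 x * (b.app (coordField 1)).comp k x := by
  ext x
  simp only [VField.comp, Tensor11.app, coordField_zero, coordField_one]
  exact tan_apply _ _ _

theorem bracket_one {X Y : VField} (hX : SmoothVField X) (hY : SmoothVField Y) (x : Fin 2 → ℝ) :
    (bracket X Y (toH2 x) : Mink) 1
      = (X.comp 0 x * pderiv 0 (Y.comp 0) x + X.comp 1 x * pderiv 1 (Y.comp 0) x)
        - (Y.comp 0 x * pderiv 0 (X.comp 0) x + Y.comp 1 x * pderiv 1 (X.comp 0) x) := by
  rw [bracket_coe hX hY, Pi.sub_apply]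
  exact congrArg₂ _ (dH_amb_succ hY 0 x _) (dH_amb_succ hX 0 x _)

theorem bracket_two {X Y : VField} (hX : SmoothVField X) (hY : SmoothVField Y) (x : Fin 2 → ℝ) :
    (bracket X Y (toH2 x) : Mink) 2
      = (X.comp 0 x * pderiv 0 (Y.comp 1) x + X.comp 1 x * pderiv 1 (Y.comp 1) x)
        - (Y.comp 0 x * pderiv 0 (X.comp 1) x + Y.comp 1 x * pderiv 1 (X.comp 1) x) := by
  rw [bracket_coe hX hY, Pi.sub_apply]
  exact congrArg₂ _ (dH_amb_succ hY 1 x _) (dH_amb_succ hX 1 x _)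

/-- The connection contributes only `(g(Y, bX) - g(X, bY)) x_k`, which self-adjointness kills, and
the bracket cancels the derivatives of `X` and `Y`. What remains is the ordinary curl of the
coefficients of `b`. -/
theorem dNabla_succ {b : Tensor11} (hb : b.Smooth) (hs : b.SelfAdjoint) {X Y : VField}
    (hX : SmoothVField X) (hY : SmoothVField Y) (x : Fin 2 → ℝ) (k : Fin 2) :
    (dNabla b X Y (toH2 x) : Mink) k.succ = (X.comp 0 x * Y.comp 1 x - X.comp 1 x * Y.comp 0 x)
      * (pderiv 0 ((b.app (coordField 1)).comp k) x
        - pderiv 1 ((b.app (coordField 0)).comp k) x) := by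
  have hb0 := ((hb _ (smooth_coordField 0)).comp k).differentiableAt_of_infty x
  have hb1 := ((hb _ (smooth_coordField 1)).comp k).differentiableAt_of_infty x
  have hX0 := (hX.comp 0).differentiableAt_of_infty x
  have hX1 := (hX.comp 1).differentiableAt_of_infty x
  have hY0 := (hY.comp 0).differentiableAt_of_infty x
  have hY1 := (hY.comp 1).differentiableAt_of_infty x
  have hg : mink (X (toH2 x)) ((b.app Y) (toH2 x)) = mink (Y (toH2 x)) ((b.app X) (toH2 x)) := by
    rw [mink_comm (Y (toH2 x) : Mink)]
    exact (hs (toH2 x) _ _).symm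
  have hbr : (b (toH2 x) (bracket X Y (toH2 x)) : Mink) k.succ
      = (bracket X Y (toH2 x) : Mink) 1 * (b.app (coordField 0)).comp k x
        + (bracket X Y (toH2 x) : Mink) 2 * (b.app (coordField 1)).comp k x := by
    simp only [VField.comp, Tensor11.app, coordField_zero, coordField_one]
    exact tan_apply _ _ _
  rw [dNabla, Submodule.coe_sub, Submodule.coe_sub, Pi.sub_apply, Pi.sub_apply, hbr, bracket_one hX hY, bracket_two hX hY,
    nabla_succ (hb Y hY), nabla_succ (hb X hX), hg, comp_app b X, comp_app b Y]
  simp (disch := first | assumption | fun_prop) only [pderiv_add, pderiv_mul]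
  simp only [VField.one_eq_comp, VField.two_eq_comp]
  ring

theorem codazzi_iff {b : Tensor11} (hb : b.Smooth) (hs : b.SelfAdjoint) :
    b.Codazzi ↔ ∀ x k, pderiv 0 ((b.app (coordField 1)).comp k) x
      = pderiv 1 ((b.app (coordField 0)).comp k) x := by
  constructor
  · intro h x k
    have h1 := dNabla_succ hb hs (smooth_coordField 0) (smooth_coordField 1) x k
    rw [h _ _ (smooth_coordField 0) (smooth_coordField 1)] at h1
    simp [comp_coordField] at h1
    linarith
  · intro h X Y hX hY
    rw [forall_H2]
    intro x
    apply tan_ext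
    · have := dNabla_succ hb hs hX hY x 0
      rw [h, sub_self, mul_zero] at this
      exact this
    · have := dNabla_succ hb hs hX hY x 1
      rw [h, sub_self, mul_zero] at this
      exact this

/-- The function `Δu - 2u` in the global chart. -/
def jacobi (u : H2 → ℝ) (x : Fin 2 → ℝ) : ℝ := laplacian u (toH2 x) - 2 * u (toH2 x)

/-! ### The Codazzi equation in terms of `Δu - 2u`. -/

section Jacobi

variable {u : H2 → ℝ}

theorem jacobi_eq (hu : SmoothH2 u) : jacobi u = fun x =>
    (1 + x 0 ^ 2) * pderiv 0 (pderiv 0 (u ∘ toH2)) x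
      + 2 * (x 0 * x 1) * pderiv 0 (pderiv 1 (u ∘ toH2)) x
      + (1 + x 1 ^ 2) * pderiv 1 (pderiv 1 (u ∘ toH2)) x
      + 2 * (x 0 * pderiv 0 (u ∘ toH2) x + x 1 * pderiv 1 (u ∘ toH2) x) - 2 * (u ∘ toH2) x := by
  ext x
  rw [jacobi, laplacian_toH2 hu]
  rfl

/-- The term `-2u` cancels exactly the first derivative of `u` produced by the first-order part of
`Δ`. -/
theorem pderiv_zero_jacobi (hu : SmoothH2 u) (x : Fin 2 → ℝ) : pderiv 0 (jacobi u) x =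
    (1 + x 0 ^ 2) * pderiv 0 (pderiv 0 (pderiv 0 (u ∘ toH2))) x
      + 2 * (x 0 * x 1) * pderiv 0 (pderiv 0 (pderiv 1 (u ∘ toH2))) x
      + (1 + x 1 ^ 2) * pderiv 0 (pderiv 1 (pderiv 1 (u ∘ toH2))) x
      + 4 * (x 0 * pderiv 0 (pderiv 0 (u ∘ toH2)) x
        + x 1 * pderiv 0 (pderiv 1 (u ∘ toH2)) x) := by
  have hf : ContDiff ℝ ∞ (u ∘ toH2) := hu
  have hd := hf.differentiableAt_of_infty x
  have h0 := contDiff_pderiv 0 hf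
  have h1 := contDiff_pderiv 1 hf
  rw [jacobi_eq hu]
  simp (disch := first | assumption | fun_prop (disch := assumption)) only [pderiv_add, pderiv_sub,
    pderiv_mul, pderiv_const, pderiv_coord, pderiv_pow]
  simp
  ring

theorem pderiv_one_jacobi (hu : SmoothH2 u) (x : Fin 2 → ℝ) : pderiv 1 (jacobi u) x =
    (1 + x 0 ^ 2) * pderiv 0 (pderiv 0 (pderiv 1 (u ∘ toH2))) x
      + 2 * (x 0 * x 1) * pderiv 0 (pderiv 1 (pderiv 1 (u ∘ toH2))) x
      + (1 + x 1 ^ 2) * pderiv 1 (pderiv 1 (pderiv 1 (u ∘ toH2))) x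
      + 4 * (x 0 * pderiv 0 (pderiv 1 (u ∘ toH2)) x
        + x 1 * pderiv 1 (pderiv 1 (u ∘ toH2)) x) := by
  have hf : ContDiff ℝ ∞ (u ∘ toH2) := hu
  have hd := hf.differentiableAt_of_infty x
  have h0 := contDiff_pderiv 0 hf
  have h1 := contDiff_pderiv 1 hf
  rw [jacobi_eq hu]
  simp (disch := first | assumption | fun_prop (disch := assumption)) only [pderiv_add, pderiv_sub,
    pderiv_mul, pderiv_const, pderiv_coord, pderiv_pow]
  rw [pderiv_comm 1 0 h0, pderiv_comm 1 0 h1, pderiv_comm 1 0 hf]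
  simp
  ring

/-- With `curl_lieTensor_one`, this says `d^∇ b (∂₀, ∂₁) = grad (Δu - 2u) / h`. Invariantly, `d^∇
Hess u (X, Y) = R(X, Y) grad u`: curvature `-1` yields `-2 grad u`, and the trace term of `b` yields
`grad Δu`. -/
theorem curl_lieTensor_zero (hu : SmoothH2 u) (x : Fin 2 → ℝ) :
    pderiv 0 (((lieTensor u).app (coordField 1)).comp 0) x
        - pderiv 1 (((lieTensor u).app (coordField 0)).comp 0) x
      = ((1 + x 0 ^ 2) * pderiv 0 (jacobi u) x + x 0 * x 1 * pderiv 1 (jacobi u) x)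
        / height x := by
  have hf : ContDiff ℝ ∞ (u ∘ toH2) := hu
  have h0 := contDiff_pderiv 0 hf
  have h1 := contDiff_pderiv 1 hf
  have hs := height_ne_zero x
  have h2 := height_sq x
  rw [pderiv_zero_jacobi hu, pderiv_one_jacobi hu,
    show ((lieTensor u).app (coordField 1)).comp 0 = _ from
      funext fun x => lieTensor_one hu x (coordField 1 (toH2 x)),
    show ((lieTensor u).app (coordField 0)).comp 0 = _ from
      funext fun x => lieTensor_one hu x (coordField 0 (toH2 x))]
  simp only [coordField_zero, coordField_one, tanMk_one, tanMk_two, zero_mul, zero_div, neg_zero,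
    zero_add, add_zero, one_mul]
  simp (disch := first | assumption | fun_prop (disch := assumption)) only [pderiv_add, pderiv_sub,
    pderiv_mul, pderiv_const, pderiv_coord, pderiv_pow, pderiv_neg, pderiv_div, pderiv_height]
  rw [pderiv_comm 1 0 h0, pderiv_comm 1 0 h1, pderiv_comm 1 0 hf]
  simp
  field_simp
  rw [h2]
  ring

theorem curl_lieTensor_one (hu : SmoothH2 u) (x : Fin 2 → ℝ) :
    pderiv 0 (((lieTensor u).app (coordField 1)).comp 1) x
        - pderiv 1 (((lieTensor u).app (coordField 0)).comp 1) x
      = (x 0 * x 1 * pderiv 0 (jacobi u) x + (1 + x 1 ^ 2) * pderiv 1 (jacobi u) x)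
        / height x := by
  have hf : ContDiff ℝ ∞ (u ∘ toH2) := hu
  have h0 := contDiff_pderiv 0 hf
  have h1 := contDiff_pderiv 1 hf
  have hs := height_ne_zero x
  have h2 := height_sq x
  rw [pderiv_zero_jacobi hu, pderiv_one_jacobi hu,
    show ((lieTensor u).app (coordField 1)).comp 1 = _ from
      funext fun x => lieTensor_two hu x (coordField 1 (toH2 x)),
    show ((lieTensor u).app (coordField 0)).comp 1 = _ from
      funext fun x => lieTensor_two hu x (coordField 0 (toH2 x))]
  simp only [coordField_zero, coordField_one, tanMk_one, tanMk_two, zero_mul, zero_div, neg_zero,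
    zero_add, add_zero, one_mul]
  simp (disch := first | assumption | fun_prop (disch := assumption)) only [pderiv_add, pderiv_sub,
    pderiv_mul, pderiv_const, pderiv_coord, pderiv_pow, pderiv_neg, pderiv_div, pderiv_height]
  rw [pderiv_comm 1 0 h0, pderiv_comm 1 0 h1, pderiv_comm 1 0 hf]
  simp
  field_simp
  rw [h2]
  ring

theorem codazzi_lieTensor_iff {V : VField} (hV : SmoothVField V) (hu : SmoothH2 u)
    (h : ∀ p, V p = J p (grad u p)) : (lieTensor u).Codazzi ↔
      ∀ x, pderiv 0 (jacobi u) x = 0 ∧ pderiv 1 (jacobi u) x = 0 := by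
  have hL := isLieTensor_lieTensor hV hu h
  rw [codazzi_iff hL.1 hL.2.1]
  refine forall_congr' fun x => ?_
  have hs := height_ne_zero x
  rw [Fin.forall_fin_two, ← sub_eq_zero, curl_lieTensor_zero hu,
    ← sub_eq_zero (a := pderiv 0 (((lieTensor u).app (coordField 1)).comp 1) x),
    curl_lieTensor_one hu]
  constructor
  · rintro ⟨e0, e1⟩
    rw [div_eq_zero_iff, or_iff_left hs] at e0 e1
    -- This is the determinant of the matrix `δ_ij + x_i x_j`; the coefficients below are its
    -- cofactors.
    have hD : 1 + x 0 ^ 2 + x 1 ^ 2 ≠ 0 := by positivity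
    constructor <;> apply mul_left_cancel₀ hD
    · linear_combination (1 + x 1 ^ 2) * e0 - x 0 * x 1 * e1
    · linear_combination (1 + x 0 ^ 2) * e1 - x 0 * x 1 * e0
  · rintro ⟨e0, e1⟩
    simp [e0, e1]

end Jacobi

/-! ### The metrics `g` and `𝔾` in the global charts -/

/-- The square of the time coordinate of the point of `ℍ²` with spatial coordinates `x`. -/
def heightSq (x : Fin 2 → ℝ) : ℝ := 1 + x 0 ^ 2 + x 1 ^ 2

theorem heightSq_ne_zero (x : Fin 2 → ℝ) : heightSq x ≠ 0 := by
  unfold heightSq; positivity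

theorem heightSq_eq (x : Fin 2 → ℝ) : heightSq x = height x ^ 2 := (height_sq x).symm

theorem coordField_succ (x : Fin 2 → ℝ) (j k : Fin 2) :
    (coordField j (toH2 x) : Mink) k.succ = if k = j then 1 else 0 := by
  change (coordField j).comp k x = _
  rw [comp_coordField, Pi.single_apply]

theorem coordField_time (x : Fin 2 → ℝ) (j : Fin 2) :
    (coordField j (toH2 x) : Mink) 0 = x j / height x := by
  rw [tan_zero, VField.one_eq_comp, VField.two_eq_comp, comp_coordField, comp_coordField]
  revert j
  simp [Fin.forall_fin_two]

theorem mink_coordField (x : Fin 2 → ℝ) (w : Tan (toH2 x)) (j : Fin 2) :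
    mink w (coordField j (toH2 x)) = (w : Mink) j.succ
      - x j * (x 0 * (w : Mink) 1 + x 1 * (w : Mink) 2) / heightSq x := by
  have h0 := heightSq_ne_zero x
  rw [mink_tan, ← heightSq, VField.one_eq_comp, VField.two_eq_comp, comp_coordField,
    comp_coordField]
  revert j
  rw [Fin.forall_fin_two]
  constructor <;> simp <;> ring

theorem gCoord_apply (x : Fin 2 → ℝ) (i j : Fin 2) :
    gCoord x i j = (if i = j then 1 else 0) - x i * x j / heightSq x := by
  change mink (coordField i (toH2 x)) (coordField j (toH2 x)) = _
  rw [mink_coordField, coordField_succ, VField.one_eq_comp, VField.two_eq_comp, comp_coordField,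
    comp_coordField]
  revert i j
  simp only [Fin.forall_fin_two]
  and_intros <;> simp <;> ring

theorem gCoord_mul (x : Fin 2 → ℝ) :
    gCoord x * (Matrix.of fun i j => (if i = j then 1 else 0) + x i * x j) = 1 := by
  have h0 := heightSq_ne_zero x
  ext i j
  rw [Matrix.mul_apply, Fin.sum_univ_two, Matrix.one_apply]
  simp only [gCoord_apply, Matrix.of_apply]
  revert i j
  simp only [Fin.forall_fin_two]
  and_intros <;> simp <;> field_simp <;> simp only [heightSq] <;> ring

theorem gCoord_inv (x : Fin 2 → ℝ) :
    (gCoord x)⁻¹ = Matrix.of fun i j => (if i = j then 1 else 0) + x i * x j :=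
  Matrix.inv_eq_right_inv (gCoord_mul x)

/-- The vertical projection changes the fibre velocity by a multiple of `p`, invisible to tangent
vectors, so `𝔾` can be computed from ambient components. -/
theorem bigG_eq (p : H2) (v : Tan p) (ζ ξ : TanT p v) :
    bigG p v ζ ξ = mink ζ.1.1 ξ.1.2 + mink ζ.1.2 ξ.1.1 := by
  have h1 : mink p ζ.1.1 = 0 := ζ.2.1
  have h2 : mink p ξ.1.1 = 0 := ξ.2.1
  change mink ζ.1.1 (ξ.1.2 + mink p ξ.1.2 • (p : Mink))
    + mink (ζ.1.2 + mink p ζ.1.2 • (p : Mink)) ξ.1.1 = _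
  rw [mink_comm (ζ.1.2 + _) ξ.1.1, mink_add_right, mink_add_right, mink_smul_right,
    mink_smul_right, mink_comm ζ.1.1 p, mink_comm ξ.1.1 p, h1, h2, mink_comm ζ.1.2]
  ring

/-- When the base point moves with the spatial components of `v` fixed, `⟨p, v⟩ = 0` forces the time
component of `v` to vary. -/
theorem chartTanT_symm_inl (p : H2) (v : Tan p) (j : Fin 2) :
    ((chartTanT p v).symm (Pi.single (.inl j) 1) : Mink × Mink)
      = ((coordField j p : Mink), ![mink v (coordField j p) / (p : Mink) 0, 0, 0]) := by
  have e : (Pi.single (.inl j) 1 : Fin 2 ⊕ Fin 2 → ℝ) ∘ .inl = Pi.single j 1 := by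
    ext i; simp [Pi.single_apply]
  change (((chartTan p).symm ((Pi.single (.inl j) 1 : Fin 2 ⊕ Fin 2 → ℝ) ∘ .inl) : Mink),
    (_ : Mink)) = _
  rw [e]
  simp [coordField]

theorem chartTanT_symm_inr (p : H2) (v : Tan p) (j : Fin 2) :
    ((chartTanT p v).symm (Pi.single (.inr j) 1) : Mink × Mink)
      = (0, (coordField j p : Mink)) := by
  have e : (Pi.single (.inr j) 1 : Fin 2 ⊕ Fin 2 → ℝ) ∘ .inl = 0 := by
    ext i; simp
  change (((chartTan p).symm ((Pi.single (.inr j) 1 : Fin 2 ⊕ Fin 2 → ℝ) ∘ .inl) : Mink),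
    (_ : Mink)) = _
  rw [e]
  simp [coordField, chartTan, mink, Pi.single_apply]

/-- Writing `v` for the fibre coordinates, the first block is `v^k ∂_k g_ij`: `𝔾` is the complete
lift of `g`. The last block vanishes because vertical vectors are isotropic. -/
theorem bigGCoord_eq (q : Fin 2 ⊕ Fin 2 → ℝ) : bigGCoord q = Matrix.fromBlocks
    (Matrix.of fun i j => 2 * q (.inl i) * q (.inl j)
        * (q (.inl 0) * q (.inr 0) + q (.inl 1) * q (.inr 1)) / heightSq (q ∘ .inl) ^ 2
      - (q (.inl i) * q (.inr j) + q (.inl j) * q (.inr i)) / heightSq (q ∘ .inl))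
    (gCoord (q ∘ .inl)) (gCoord (q ∘ .inl)) 0 := by
  have h0 := height_ne_zero (q ∘ .inl)
  have hv : ∀ j : Fin 2, ((chartTan (toH2 (q ∘ .inl))).symm (q ∘ .inr) : Mink) j.succ
      = q (.inr j) := by simp only [Fin.forall_fin_two]; exact ⟨rfl, rfl⟩
  have hv1 : ((chartTan (toH2 (q ∘ .inl))).symm (q ∘ .inr) : Mink) 1 = q (.inr 0) := rfl
  have hv2 : ((chartTan (toH2 (q ∘ .inl))).symm (q ∘ .inr) : Mink) 2 = q (.inr 1) := rfl
  have ht : ∀ (j : Fin 2) (c : ℝ), mink (coordField j (toH2 (q ∘ .inl))) ![c, 0, 0]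
      = -(q (.inl j) / height (q ∘ .inl) * c) := by
    intro j c
    simp [mink, coordField_time]
  ext A B
  simp only [bigGCoord, Matrix.of_apply, bigG_eq]
  rcases A with i | i <;> rcases B with j | j
  · rw [chartTanT_symm_inl, chartTanT_symm_inl, Matrix.fromBlocks_apply₁₁, Matrix.of_apply,
      mink_comm ![_, _, _], ht, ht, mink_coordField, mink_coordField, hv, hv, hv1, hv2, toH2_zero,
      heightSq_eq]
    simp only [Function.comp_apply]
    field_simp
    ring
  · rw [chartTanT_symm_inl, chartTanT_symm_inr, Matrix.fromBlocks_apply₁₂]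
    change _ = mink (coordField i _) (coordField j _)
    simp [mink]
  · rw [chartTanT_symm_inl, chartTanT_symm_inr, Matrix.fromBlocks_apply₂₁]
    change _ = mink (coordField i _) (coordField j _)
    simp [mink]
  · rw [chartTanT_symm_inr, chartTanT_symm_inr, Matrix.fromBlocks_apply₂₂]
    simp [mink]

/-- The last block is `v^k ∂_k g^ij`, the derivative of the inverse metric along the fibre vector.
-/
theorem bigGCoord_inv (q : Fin 2 ⊕ Fin 2 → ℝ) : (bigGCoord q)⁻¹ = Matrix.fromBlocks
    0 (Matrix.of fun i j => (if i = j then 1 else 0) + q (.inl i) * q (.inl j))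
    (Matrix.of fun i j => (if i = j then 1 else 0) + q (.inl i) * q (.inl j))
    (Matrix.of fun i j => q (.inl i) * q (.inr j) + q (.inr i) * q (.inl j)) := by
  have h0 := heightSq_ne_zero (q ∘ .inl)
  refine Matrix.inv_eq_right_inv ?_
  have hg := gCoord_mul (q ∘ .inl)
  rw [bigGCoord_eq, Matrix.fromBlocks_multiply, ← Matrix.fromBlocks_one]
  congr 1
  · simpa using hg
  · ext i j
    simp only [Matrix.add_apply, Matrix.mul_apply, Fin.sum_univ_two, gCoord_apply, Matrix.of_apply]
    revert i j
    simp only [Fin.forall_fin_two]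
    and_intros <;> simp <;> field_simp <;> simp only [heightSq, Function.comp] <;> ring
  · simp
  · simpa using hg

/-! ### Derivatives of the metric coefficients -/

theorem differentiable_heightSq : Differentiable ℝ heightSq := by
  unfold heightSq
  fun_prop

theorem pderiv_heightSq (k : Fin 2) (x : Fin 2 → ℝ) : pderiv k heightSq x = 2 * x k := by
  unfold heightSq
  simp (disch := fun_prop) only [pderiv_add, pderiv_pow, pderiv_const, pderiv_coord]
  revert k
  simp [Fin.forall_fin_two]

theorem differentiable_heightSq_inl :
    Differentiable ℝ fun q : Fin 2 ⊕ Fin 2 → ℝ => heightSq (q ∘ .inl) := by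
  simp only [heightSq, Function.comp]
  fun_prop

theorem pderiv_inl_comp {f : (Fin 2 → ℝ) → ℝ} (q : Fin 2 ⊕ Fin 2 → ℝ)
    (hf : DifferentiableAt ℝ f (q ∘ .inl)) (k : Fin 2) :
    pderiv (.inl k) (fun q : Fin 2 ⊕ Fin 2 → ℝ => f (q ∘ .inl)) q = pderiv k f (q ∘ .inl) := by
  let r : (Fin 2 ⊕ Fin 2 → ℝ) →L[ℝ] (Fin 2 → ℝ) :=
    ContinuousLinearMap.pi fun i => ContinuousLinearMap.proj (.inl i)
  have h := (show DifferentiableAt ℝ f (r q) from hf).hasFDerivAt.comp q r.hasFDerivAt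
  rw [pderiv, show fderiv ℝ (fun q : Fin 2 ⊕ Fin 2 → ℝ => f (q ∘ .inl)) q = _ from h.fderiv,
    ContinuousLinearMap.comp_apply, show r (Pi.single (.inl k) 1) = Pi.single k 1 by
      ext i; simp [r, Pi.single_apply]]
  rfl

theorem pderiv_inr_comp {f : (Fin 2 → ℝ) → ℝ} (q : Fin 2 ⊕ Fin 2 → ℝ)
    (hf : DifferentiableAt ℝ f (q ∘ .inl)) (k : Fin 2) :
    pderiv (.inr k) (fun q : Fin 2 ⊕ Fin 2 → ℝ => f (q ∘ .inl)) q = 0 := by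
  let r : (Fin 2 ⊕ Fin 2 → ℝ) →L[ℝ] (Fin 2 → ℝ) :=
    ContinuousLinearMap.pi fun i => ContinuousLinearMap.proj (.inl i)
  have h := (show DifferentiableAt ℝ f (r q) from hf).hasFDerivAt.comp q r.hasFDerivAt
  rw [pderiv, show fderiv ℝ (fun q : Fin 2 ⊕ Fin 2 → ℝ => f (q ∘ .inl)) q = _ from h.fderiv,
    ContinuousLinearMap.comp_apply, show r (Pi.single (.inr k) 1) = 0 by
      ext i; simp [r], map_zero]

theorem differentiableAt_gCoord (i j : Fin 2) (x : Fin 2 → ℝ) :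
    DifferentiableAt ℝ (fun y => gCoord y i j) x := by
  have h := (differentiable_heightSq x).inv (heightSq_ne_zero x)
  simp only [gCoord_apply, div_eq_mul_inv]
  exact (differentiableAt_const _).sub (DifferentiableAt.mul (by fun_prop) h)

theorem pderiv_gCoord (k i j : Fin 2) (x : Fin 2 → ℝ) :
    pderiv k (fun y => gCoord y i j) x = 2 * x i * x j * x k / heightSq x ^ 2
      - ((if i = k then 1 else 0) * x j + (if j = k then 1 else 0) * x i) / heightSq x := by
  have h0 := heightSq_ne_zero x
  have hd := differentiable_heightSq x
  have hq : DifferentiableAt ℝ (fun y => y i * y j / heightSq y) x := by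
    simp only [div_eq_mul_inv]
    exact DifferentiableAt.mul (by fun_prop) (hd.inv h0)
  simp only [gCoord_apply]
  simp (disch := first | assumption | fun_prop) only [pderiv_sub, pderiv_const, pderiv_div,
    pderiv_mul, pderiv_coord, pderiv_heightSq]
  field_simp
  ring

theorem christoffel_gCoord (k i j : Fin 2) (x : Fin 2 → ℝ) :
    christoffel gCoord k i j x = -(gCoord x i j * x k) := by
  have h0 := heightSq_ne_zero x
  simp only [christoffel, gCoord_inv, pderiv_gCoord, Fin.sum_univ_two, Matrix.of_apply]
  simp only [gCoord_apply]
  revert k i j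
  simp only [Fin.forall_fin_two]
  and_intros <;> simp <;> field_simp <;> simp only [heightSq] <;> ring

section BigG

variable (k i j : Fin 2) (q : Fin 2 ⊕ Fin 2 → ℝ)

theorem pderiv_inl_bigG_inl_inl : pderiv (.inl k) (fun q => bigGCoord q (.inl i) (.inl j)) q
    = (2 * ((if i = k then 1 else 0) * q (.inl j) + (if j = k then 1 else 0) * q (.inl i))
          * (q (.inl 0) * q (.inr 0) + q (.inl 1) * q (.inr 1))
        + 2 * q (.inl i) * q (.inl j) * q (.inr k)
        + 2 * q (.inl k) * (q (.inl i) * q (.inr j) + q (.inl j) * q (.inr i)))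
        / heightSq (q ∘ .inl) ^ 2
      - 8 * q (.inl i) * q (.inl j) * q (.inl k)
          * (q (.inl 0) * q (.inr 0) + q (.inl 1) * q (.inr 1)) / heightSq (q ∘ .inl) ^ 3
      - ((if i = k then 1 else 0) * q (.inr j) + (if j = k then 1 else 0) * q (.inr i))
        / heightSq (q ∘ .inl) := by
  have h0 := heightSq_ne_zero (q ∘ .inl)
  have h0' := pow_ne_zero 2 h0
  have hd := differentiable_heightSq_inl q
  have hd' := hd.pow 2
  have hi := hd.inv h0
  have hi' := hd'.inv h0'
  have hk := pderiv_inl_comp q (differentiable_heightSq _) k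
  rw [pderiv_heightSq, Function.comp_apply] at hk
  simp only [bigGCoord_eq, Matrix.fromBlocks_apply₁₁, Matrix.of_apply]
  rw [pderiv_sub _ (by simp only [div_eq_mul_inv]; exact DifferentiableAt.mul (by fun_prop) hi')
    (by simp only [div_eq_mul_inv]; exact DifferentiableAt.mul (by fun_prop) hi)]
  simp (disch := first | assumption | fun_prop) only [pderiv_add, pderiv_const, pderiv_div,
    pderiv_mul, pderiv_pow, pderiv_coord, hk]
  revert k
  simp only [Fin.forall_fin_two]
  refine ⟨fun _ => ?_, fun _ => ?_⟩ <;> simp <;> field_simp <;> split_ifs <;> ring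

/-- The block is linear in the fibre coordinates with coefficients `∂_k g_ij`, which this recovers.
-/
theorem pderiv_inr_bigG_inl_inl : pderiv (.inr k) (fun q => bigGCoord q (.inl i) (.inl j)) q
    = 2 * q (.inl i) * q (.inl j) * q (.inl k) / heightSq (q ∘ .inl) ^ 2
      - ((if i = k then 1 else 0) * q (.inl j) + (if j = k then 1 else 0) * q (.inl i))
        / heightSq (q ∘ .inl) := by
  have h0 := heightSq_ne_zero (q ∘ .inl)
  have h0' := pow_ne_zero 2 h0
  have hd := differentiable_heightSq_inl q
  have hd' := hd.pow 2
  have hi := hd.inv h0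
  have hi' := hd'.inv h0'
  have hk := pderiv_inr_comp q (differentiable_heightSq _) k
  simp only [bigGCoord_eq, Matrix.fromBlocks_apply₁₁, Matrix.of_apply]
  rw [pderiv_sub _ (by simp only [div_eq_mul_inv]; exact DifferentiableAt.mul (by fun_prop) hi')
    (by simp only [div_eq_mul_inv]; exact DifferentiableAt.mul (by fun_prop) hi)]
  simp (disch := first | assumption | fun_prop) only [pderiv_add, pderiv_const, pderiv_div,
    pderiv_mul, pderiv_pow, pderiv_coord, hk]
  revert k
  simp only [Fin.forall_fin_two]
  refine ⟨fun _ => ?_, fun _ => ?_⟩ <;> simp <;> field_simp <;> split_ifs <;> ring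

theorem pderiv_inl_bigG_inl_inr : pderiv (.inl k) (fun q => bigGCoord q (.inl i) (.inr j)) q
    = pderiv k (fun y => gCoord y i j) (q ∘ .inl) := by
  simp only [bigGCoord_eq, Matrix.fromBlocks_apply₁₂]
  exact pderiv_inl_comp q (differentiableAt_gCoord i j _) k

theorem pderiv_inr_bigG_inl_inr :
    pderiv (.inr k) (fun q => bigGCoord q (.inl i) (.inr j)) q = 0 := by
  simp only [bigGCoord_eq, Matrix.fromBlocks_apply₁₂]
  exact pderiv_inr_comp q (differentiableAt_gCoord i j _) k

theorem pderiv_inl_bigG_inr_inl : pderiv (.inl k) (fun q => bigGCoord q (.inr i) (.inl j)) q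
    = pderiv k (fun y => gCoord y i j) (q ∘ .inl) := by
  simp only [bigGCoord_eq, Matrix.fromBlocks_apply₂₁]
  exact pderiv_inl_comp q (differentiableAt_gCoord i j _) k

theorem pderiv_inr_bigG_inr_inl :
    pderiv (.inr k) (fun q => bigGCoord q (.inr i) (.inl j)) q = 0 := by
  simp only [bigGCoord_eq, Matrix.fromBlocks_apply₂₁]
  exact pderiv_inr_comp q (differentiableAt_gCoord i j _) k

theorem pderiv_bigG_inr_inr (A : Fin 2 ⊕ Fin 2) :
    pderiv A (fun q => bigGCoord q (.inr i) (.inr j)) q = 0 := by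
  simp only [bigGCoord_eq, Matrix.fromBlocks_apply₂₂]
  exact pderiv_const _ _ _

/-- The base symbols are those of `g`, and symbols with a fibre index vanish: geodesics of `𝔾`
project to geodesics of `g`. -/
theorem christoffel_bigG_inl (A B : Fin 2 ⊕ Fin 2) : christoffel bigGCoord (.inl k) A B q =
    Sum.elim (fun i => Sum.elim (fun j => -(gCoord (q ∘ .inl) i j * q (.inl k))) 0 B) 0 A := by
  have h0 := heightSq_ne_zero (q ∘ .inl)
  rcases A with i | i <;> rcases B with j | j <;>
  simp only [christoffel, bigGCoord_inv, Fintype.sum_sum_type, Matrix.fromBlocks_apply₁₁,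
    Matrix.fromBlocks_apply₁₂, pderiv_inl_bigG_inl_inl, pderiv_inr_bigG_inl_inl,
    pderiv_inl_bigG_inl_inr, pderiv_inr_bigG_inl_inr, pderiv_inl_bigG_inr_inl,
    pderiv_inr_bigG_inr_inl, pderiv_bigG_inr_inr, Matrix.zero_apply, zero_mul,
    Finset.sum_const_zero, zero_add, add_zero, sub_zero, mul_zero, Sum.elim_inl, Sum.elim_inr,
    Pi.zero_apply]
  -- Only the case of two base indices is left, and it is the computation for `g`.
  have h := christoffel_gCoord k i j (q ∘ .inl)
  simp only [christoffel, gCoord_inv, pderiv_gCoord] at h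
  simp only [pderiv_gCoord]
  exact h

/-- As for any complete lift, two base indices give `v^l ∂_l Γ^k_ij`, a base and a fibre index give
`Γ^k_ij`, and two fibre indices give zero. -/
theorem christoffel_bigG_inr (A B : Fin 2 ⊕ Fin 2) : christoffel bigGCoord (.inr k) A B q =
    Sum.elim
      (fun i => Sum.elim (fun j => -(bigGCoord q (.inl i) (.inl j) * q (.inl k))
          - gCoord (q ∘ .inl) i j * q (.inr k))
        (fun j => -(gCoord (q ∘ .inl) i j * q (.inl k))) B)
      (fun i => Sum.elim (fun j => -(gCoord (q ∘ .inl) i j * q (.inl k))) 0 B) A := by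
  have h0 := heightSq_ne_zero (q ∘ .inl)
  rcases A with i | i <;> rcases B with j | j <;>
  simp only [christoffel, bigGCoord_inv, Fintype.sum_sum_type, Matrix.fromBlocks_apply₂₁,
    Matrix.fromBlocks_apply₂₂, pderiv_inl_bigG_inl_inl, pderiv_inr_bigG_inl_inl,
    pderiv_inl_bigG_inl_inr, pderiv_inr_bigG_inl_inr, pderiv_inl_bigG_inr_inl,
    pderiv_inr_bigG_inr_inl, pderiv_bigG_inr_inr, mul_zero, pderiv_gCoord,
    Finset.sum_const_zero, add_zero, sub_zero, Sum.elim_inl, Sum.elim_inr,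
    Pi.zero_apply, Fin.sum_univ_two, Matrix.of_apply]
  · simp only [bigGCoord_eq, Matrix.fromBlocks_apply₁₁, gCoord_apply, Matrix.of_apply]
    revert k i j
    simp only [Fin.forall_fin_two]
    and_intros <;> simp <;> field_simp <;> simp only [heightSq, Function.comp] <;> ring
  · simp only [gCoord_apply]
    revert k i j
    simp only [Fin.forall_fin_two]
    and_intros <;> simp <;> field_simp <;> simp only [heightSq, Function.comp] <;> ring
  · simp only [gCoord_apply]
    revert k i j
    simp only [Fin.forall_fin_two]
    and_intros <;> simp <;> field_simp <;> simp only [heightSq, Function.comp] <;> ring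

end BigG

/-! ### The tension field of a vector field -/

/-- The base part is the tension of the identity of `ℍ²`, whatever `V` is. -/
theorem tension_inl (V : VField) (k : Fin 2) (x : Fin 2 → ℝ) :
    tension gCoord bigGCoord (sectionCoord V) x (.inl k) = 0 := by
  have e1 : ∀ k : Fin 2, (fun z => sectionCoord V z (.inl k)) = fun z => z k := fun k => rfl
  have e3 : sectionCoord V x ∘ .inl = x := rfl
  simp only [tension, secondDeriv, christoffel_gCoord, christoffel_bigG_inl,
    Fintype.sum_sum_type, Sum.elim_inl, Sum.elim_inr, Pi.zero_apply, zero_mul,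
    Finset.sum_const_zero, add_zero, e1, e3, pderiv_const, pderiv_coord]
  simp [sectionCoord]

/-- The fibre part is linear in `V`: it is the linearization at the identity of the tension field of
self-maps of `ℍ²`. -/
theorem tension_inr (V : VField) (k : Fin 2) (x : Fin 2 → ℝ) :
    tension gCoord bigGCoord (sectionCoord V) x (.inr k) =
      (1 + x 0 ^ 2) * pderiv 0 (pderiv 0 (V.comp k)) x
        + x 0 * x 1 * pderiv 0 (pderiv 1 (V.comp k)) x
        + x 0 * x 1 * pderiv 1 (pderiv 0 (V.comp k)) x
        + (1 + x 1 ^ 2) * pderiv 1 (pderiv 1 (V.comp k)) x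
        + 2 * (x 0 * V.comp 0 x + x 1 * V.comp 1 x) * x k / heightSq x - 2 * V.comp k x
        - 2 * x k * (pderiv 0 (V.comp 0) x + pderiv 1 (V.comp 1) x)
        + 2 * (x 0 * pderiv 0 (V.comp k) x + x 1 * pderiv 1 (V.comp k) x) := by
  have h0 := heightSq_ne_zero x
  have e1 : ∀ k : Fin 2, (fun z => sectionCoord V z (.inl k)) = fun z => z k := fun k => rfl
  have e3 : sectionCoord V x ∘ .inl = x := rfl
  have e4 : ∀ k : Fin 2, (fun z => sectionCoord V z (.inr k)) = V.comp k := by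
    simp only [Fin.forall_fin_two]; exact ⟨rfl, rfl⟩
  have e5 : ∀ k : Fin 2, sectionCoord V x (.inr k) = V.comp k x := fun k => congrFun (e4 k) x
  have e6 : ∀ k : Fin 2, sectionCoord V x (.inl k) = x k := fun k => rfl
  have e7 : ∀ j k : Fin 2, (fun y => pderiv j (V.comp k) y) = pderiv j (V.comp k) :=
    fun j k => rfl
  simp only [tension, secondDeriv, christoffel_gCoord, christoffel_bigG_inr,
    Fintype.sum_sum_type, Sum.elim_inl, Sum.elim_inr, Pi.zero_apply, zero_mul,
    add_zero, e1, e3, e4, e7, pderiv_coord, gCoord_inv, Fin.sum_univ_two,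
    Matrix.of_apply, bigGCoord_eq, Matrix.fromBlocks_apply₁₁, e5, e6, gCoord_apply]
  simp
  field_simp
  simp only [heightSq]
  ring

/-- Compared with `eq_J_grad_iff`, this and `tension_inr_one` give the two components of `J grad (Δu
- 2u)`. -/
theorem tension_inr_zero {V : VField} {u : H2 → ℝ} (hu : SmoothH2 u)
    (h : ∀ p, V p = J p (grad u p)) (x : Fin 2 → ℝ) :
    tension gCoord bigGCoord (sectionCoord V) x (.inr 0)
      = -(height x * pderiv 1 (jacobi u) x) := by
  have hf : ContDiff ℝ ∞ (u ∘ toH2) := hu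
  have h0 := contDiff_pderiv 0 hf
  have h1 := contDiff_pderiv 1 hf
  have hs := height_ne_zero x
  have h2 := height_sq x
  have h4 : height x ^ 4 = (1 + x 0 ^ 2 + x 1 ^ 2) ^ 2 := by rw [← h2]; ring
  have h' := eq_J_grad_iff.1 h
  have e0 : V.comp 0 = _ := funext fun y => (h' y).1
  have e1 : V.comp 1 = _ := funext fun y => (h' y).2
  -- The first derivatives are needed as functions, since `tension_inr` differentiates them again.
  have d : ∀ i, pderiv i (fun y => -(height y * pderiv 1 (u ∘ toH2) y))
      = fun y => -(y i / height y * pderiv 1 (u ∘ toH2) y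
        + height y * pderiv i (pderiv 1 (u ∘ toH2)) y) := by
    intro i
    funext y
    simp (disch := fun_prop) only [pderiv_neg, pderiv_mul, pderiv_height]
  have hq : ∀ i : Fin 2, DifferentiableAt ℝ (fun y : Fin 2 → ℝ => y i / height y) x := fun i => by
    simp only [div_eq_mul_inv]
    exact (differentiableAt_apply i x).mul ((differentiableAt_height x).inv hs)
  rw [tension_inr, pderiv_one_jacobi hu, e0, e1]
  simp only [d, heightSq_eq]
  simp (disch := first | assumption | fun_prop (disch := assumption)) only [pderiv_neg, pderiv_add,
    pderiv_mul, pderiv_div, pderiv_height, pderiv_coord]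
  rw [pderiv_comm 1 0 h1, pderiv_comm 1 0 hf]
  simp
  field_simp
  simp only [h4, h2]
  ring

theorem tension_inr_one {V : VField} {u : H2 → ℝ} (hu : SmoothH2 u)
    (h : ∀ p, V p = J p (grad u p)) (x : Fin 2 → ℝ) :
    tension gCoord bigGCoord (sectionCoord V) x (.inr 1)
      = height x * pderiv 0 (jacobi u) x := by
  have hf : ContDiff ℝ ∞ (u ∘ toH2) := hu
  have h0 := contDiff_pderiv 0 hf
  have h1 := contDiff_pderiv 1 hf
  have hs := height_ne_zero x
  have h2 := height_sq x
  have h4 : height x ^ 4 = (1 + x 0 ^ 2 + x 1 ^ 2) ^ 2 := by rw [← h2]; ring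
  have h' := eq_J_grad_iff.1 h
  have e0 : V.comp 0 = _ := funext fun y => (h' y).1
  have e1 : V.comp 1 = _ := funext fun y => (h' y).2
  have d : ∀ i, pderiv i (fun y => height y * pderiv 0 (u ∘ toH2) y)
      = fun y => y i / height y * pderiv 0 (u ∘ toH2) y
        + height y * pderiv i (pderiv 0 (u ∘ toH2)) y := by
    intro i
    funext y
    simp (disch := fun_prop) only [pderiv_mul, pderiv_height]
  have hq : ∀ i : Fin 2, DifferentiableAt ℝ (fun y : Fin 2 → ℝ => y i / height y) x := fun i => by
    simp only [div_eq_mul_inv]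
    exact (differentiableAt_apply i x).mul ((differentiableAt_height x).inv hs)
  rw [tension_inr, pderiv_zero_jacobi hu, e0, e1]
  simp only [d, heightSq_eq]
  simp (disch := first | assumption | fun_prop (disch := assumption)) only [pderiv_neg, pderiv_add,
    pderiv_mul, pderiv_div, pderiv_height, pderiv_coord]
  rw [pderiv_comm 1 0 h0, pderiv_comm 1 0 hf, pderiv_comm 1 0 h1]
  simp
  field_simp
  simp only [h4, h2]
  ring

theorem isHarmonicMap_iff {V : VField} {u : H2 → ℝ} (hu : SmoothH2 u)
    (h : ∀ p, V p = J p (grad u p)) : IsHarmonicMap V ↔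
      ∀ x, pderiv 0 (jacobi u) x = 0 ∧ pderiv 1 (jacobi u) x = 0 := by
  refine forall_congr' fun x => ?_
  have hs := height_ne_zero x
  rw [funext_iff, Sum.forall, Fin.forall_fin_two, Fin.forall_fin_two, tension_inl, tension_inl,
    tension_inr_zero hu h, tension_inr_one hu h]
  simp [hs, and_comm]

/-! ### Normalization of the potential -/

theorem jacobi_eq_zero_iff {u : H2 → ℝ} :
    (∀ p, laplacian u p - 2 * u p = 0) ↔ ∀ x, jacobi u x = 0 :=
  forall_H2

theorem contDiff_jacobi {u : H2 → ℝ} (hu : SmoothH2 u) : ContDiff ℝ ∞ (jacobi u) := by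
  have hf : ContDiff ℝ ∞ (u ∘ toH2) := hu
  have h0 := contDiff_pderiv 0 hf
  have h1 := contDiff_pderiv 1 hf
  have h00 := contDiff_pderiv 0 h0
  have h01 := contDiff_pderiv 0 h1
  have h11 := contDiff_pderiv 1 h1
  rw [jacobi_eq hu]
  generalize u ∘ toH2 = f at *
  fun_prop

theorem eq_const_of_pderiv_eq_zero {f : (Fin 2 → ℝ) → ℝ} (hf : ContDiff ℝ ∞ f)
    (h : ∀ x, pderiv 0 f x = 0 ∧ pderiv 1 f x = 0) (x : Fin 2 → ℝ) : f x = f 0 := by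
  refine is_const_of_fderiv_eq_zero (𝕜 := ℝ) (hf.differentiable (by simp)) (fun y => ?_) x 0
  ext1 w
  rw [fderiv_eq_pderiv]
  change w 0 • pderiv 0 f y + w 1 • pderiv 1 f y = 0
  rw [(h y).1, (h y).2]
  simp

/-- If `Δu - 2u` is constant, then adding a constant to `u` makes it vanish. -/
theorem exists_normalized_potential {V : VField} {u : H2 → ℝ} (hu : SmoothH2 u)
    (h : ∀ p, V p = J p (grad u p))
    (hL : ∀ x, pderiv 0 (jacobi u) x = 0 ∧ pderiv 1 (jacobi u) x = 0) :
    ∃ u' : H2 → ℝ, SmoothH2 u' ∧ (∀ p, laplacian u' p - 2 * u' p = 0) ∧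
      ∀ p, V p = J p (grad u' p) := by
  have hf : ContDiff ℝ ∞ (u ∘ toH2) := hu
  -- Adding a constant `c` changes `Δu - 2u` by `-2c`; its constant value is read off at the chart
  -- origin.
  let u' : H2 → ℝ := fun p => u p + jacobi u 0 / 2
  have hu' : SmoothH2 u' := hf.add contDiff_const
  have e : ∀ i, pderiv i (u' ∘ toH2) = pderiv i (u ∘ toH2) := by
    intro i
    ext x
    have := pderiv_add i (hf.differentiableAt_of_infty x)
      (differentiableAt_const (jacobi u 0 / 2))
    rwa [pderiv_const, add_zero] at this
  refine ⟨u', hu', ?_, ?_⟩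
  · rw [jacobi_eq_zero_iff]
    intro x
    have hc := eq_const_of_pderiv_eq_zero (contDiff_jacobi hu) hL x
    have h1 := congrFun (jacobi_eq hu) x
    have h2 := congrFun (jacobi_eq hu') x
    have h3 : (u' ∘ toH2) x = (u ∘ toH2) x + jacobi u 0 / 2 := rfl
    simp only [e, h3] at h2
    linarith
  · rw [eq_J_grad_iff] at h ⊢
    simpa only [e] using h

theorem pderiv_jacobi_eq_zero {u : H2 → ℝ} (h : ∀ p, laplacian u p - 2 * u p = 0)
    (x : Fin 2 → ℝ) : pderiv 0 (jacobi u) x = 0 ∧ pderiv 1 (jacobi u) x = 0 := by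
  have : jacobi u = fun _ => 0 := funext (jacobi_eq_zero_iff.1 h)
  rw [this]
  exact ⟨pderiv_const _ _ _, pderiv_const _ _ _⟩

end HalfPipe

end

/-! ### The four equivalences. -/

theorem theorem1p2 (V : VField) (hV : SmoothVField V) :
    List.TFAE [
      ∃ u : H2 → ℝ, SmoothH2 u ∧ IsMeanGraph u ∧ IsAssociatedField u V,
      ∃ u : H2 → ℝ, SmoothH2 u ∧ (∀ p, laplacian u p - 2 * u p = 0) ∧
        ∀ p, V p = J p (grad u p),
      IsHarmonicLagrangian V,
      ∃ b : Tensor11, IsLieTensor V b ∧ (∀ b', IsLieTensor V b' → b' = b) ∧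
        (∀ p, LinearMap.trace ℝ (Tan p) (b p) = 0) ∧ b.Codazzi] := by
  tfae_have 1 ↔ 2 := by
    refine exists_congr fun u => and_congr_right fun hu => ?_
    rw [isMeanGraph_iff hu, isAssociatedField_iff hu]
  tfae_have 2 → 3 := by
    rintro ⟨u, hu, hL, h⟩
    exact ⟨(isHarmonicMap_iff hu h).2 (pderiv_jacobi_eq_zero hL),
      (isLagrangian_iff hV).2 (trace_nabla_J_grad hV hu h)⟩
  tfae_have 3 → 2 := by
    rintro ⟨hH, hLag⟩
    obtain ⟨u, hu, h⟩ := exists_eq_J_grad hV ((isLagrangian_iff hV).1 hLag)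
    exact exists_normalized_potential hu h ((isHarmonicMap_iff hu h).1 hH)
  tfae_have 2 → 4 := by
    rintro ⟨u, hu, hL, h⟩
    have hb := isLieTensor_lieTensor hV hu h
    exact ⟨lieTensor u, hb, fun b' hb' => hb.unique hb',
      fun p => by rw [hb.trace_eq, trace_nabla_J_grad hV hu h, mul_zero],
      (codazzi_lieTensor_iff hV hu h).2 (pderiv_jacobi_eq_zero hL)⟩
  tfae_have 4 → 2 := by
    rintro ⟨b, hb, -, htr, hc⟩
    obtain ⟨u, hu, h⟩ := exists_eq_J_grad hV fun p => by
      have := hb.trace_eq p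
      rw [htr] at this
      linarith
    -- Uniqueness replaces the abstract `b` by `lieTensor u`, for which the Codazzi equation has
    -- been computed.
    rw [(isLieTensor_lieTensor hV hu h).unique hb] at hc
    exact exists_normalized_potential hu h ((codazzi_lieTensor_iff hV hu h).1 hc)
  tfae_finish
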